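/- **Conventions.** Cantor space $\{0,1\}^{\mathbb N}$ carries the product topology, and $\langle p,q\rangle$ denotes the interleaving of $p$ and $q$. A *represented space* $\mathbf X=(X,\delta_X)$ is a set $X$ with a partial surjection $\delta_X:\subseteq\{0,1\}^{\mathbb N}\to X$; if $\delta_X(p)=x$, then $p$ is a *name* of $x$, and $x$ is *computable* if it has a computable name. A *realizer* of a partial multi-valued function $f:\subseteq\mathbf X\rightrightarrows\mathbf Y$ is a partial function $F:\subseteq\{0,1\}^{\mathbb N}\to\{0,1\}^{\mathbb N}$ with $\delta_Y(F(p))\in f(\delta_X(p))$ for all $p$ with $\delta_X(p)\in\operatorname{dom}(f)$; $f$ is *continuous* (*computable*) if it has a continuous (computable, i.e. computed by a type-2 Turing machine) realizer. Names in $\mathbf X\times\mathbf Y$ are the pairs $\langle p,q\rangle$ of names; a subspace of $\mathbf X$ uses the names in $\mathbf X$. $\mathcal C(\mathbf X,\mathbf Y)$ is the space of functions $f:X\to Y$ that have a name, where $0^n1p$ is a name of $f$ if the $n$-th Turing machine with oracle $p$ computes a realizer of $f$. In $\mathbb N$ the name of $n$ is $0^n10^{\mathbb N}$. The space $\mathbb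 S=\{\bot,\top\}$ has $0^{\mathbb N}$ as the only name of $\bot$ and all other sequences as names of $\top$. $\mathcal O(\mathbf X)$ (open sets) and $\mathcal A(\mathbf X)$ (closed sets) arise from $\mathcal C(\mathbf X,\mathbb S)$ by identifying $f$ with $f^{-1}\{\top\}$ and with $f^{-1}\{\bot\}$, respectively. A represented space $\mathbf X$ is *compact* (*computably compact*) if $\operatorname{IsEmpty}_{\mathbf X}:\mathcal A(\mathbf X)\to\mathbb S$, with $\operatorname{IsEmpty}_{\mathbf X}(A)=\top$ iff $A=\emptyset$, is continuous (computable). **Proposition.** Let $\mathbf X$ be a represented space. The following properties are equivalent, both when read throughout without the words in parentheses and when read throughout with them, where "continuous (computable)" is read as "continuous" in the first case and as "computable" in the second: 1. $\mathbf X$ is (computably) compact. 2. $\operatorname{IsFull}_{\mathbf X}:\mathcal O(\mathbf X)\to\mathbb S$, with $\operatorname{IsFull}_{\mathbf X}(U)=\top$ iff $U=X$, is continuous (computable). 3. For every (computable) $A\in\mathcal A(\mathbf X)$ the subspace $\mathbf A$ of $\mathbf X$ is (computably) compact. 4. $\subseteq\;:\mathcal A(\mathbf X)\times\mathcal O(\mathbf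 X)\to\mathbb S$, with value $\top$ at $(A,U)$ iff $A\subseteq U$, is continuous (computable). 5. $\operatorname{IsCover}:\mathcal C(\mathbb N,\mathcal O(\mathbf X))\to\mathbb S$, with value $\top$ at $(U_n)_{n}$ iff $\bigcup_{n\in\mathbb N}U_n=X$, is continuous (computable). 6. $\operatorname{FiniteSubcover}:\subseteq\mathcal C(\mathbb N,\mathcal O(\mathbf X))\rightrightarrows\mathbb N$, with domain $\{(U_n)_n\mid\bigcup_{n\in\mathbb N}U_n=X\}$ and $N\in\operatorname{FiniteSubcover}((U_n)_n)$ iff $\bigcup_{n=0}^N U_n=X$, is continuous (computable). 7. $\operatorname{Enough}:\subseteq\mathcal C(\mathbb N,\mathcal A(\mathbf X))\rightrightarrows\mathbb N$, with domain $\{(A_i)_i\mid\bigcap_{i\in\mathbb N}A_i=\emptyset\}$ and $N\in\operatorname{Enough}((A_i)_i)$ iff $\bigcap_{i\le N}A_i=\emptyset$, is continuous (computable). 8. For every represented space $\mathbf Y$, the map $\pi_2:\mathcal A(\mathbf X\times\mathbf Y)\to\mathcal A(\mathbf Y)$, $\pi_2(A)=\{y\in Y\mid\exists x\in X\;(x,y)\in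 A\}$, is well-defined and continuous (computable). 9. For some non-empty represented space $\mathbf Y$ (containing a computable point), the map $\pi_2:\mathcal A(\mathbf X\times\mathbf Y)\to\mathcal A(\mathbf Y)$ is well-defined and continuous (computable). -/

import Mathlib

universe u v w

/-! ### Computable partial functions on Cantor space -/

/-- Cantor space `{0,1}^ℕ`, carrying the product of the discrete topologies. -/
abbrev Cantor : Type := ℕ → Bool

namespace Cantor

/-- The pairing `⟨p, q⟩ = p(0) q(0) p(1) q(1) …`. -/
def pair (p q : Cantor) : Cantor := fun i => if i % 2 = 0 then p (i / 2) else q (i / 2)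

/-- The first component of a pair of sequences. -/
def fst (r : Cantor) : Cantor := fun i => r (2 * i)

/-- The second component of a pair of sequences. -/
def snd (r : Cantor) : Cantor := fun i => r (2 * i + 1)

/-- The sequence `0ⁿ1p`. -/
def tag (n : ℕ) (p : Cantor) : Cantor := fun i =>
  if i < n then false else if i = n then true else p (i - n - 1)

/-- The sequence `0ⁿ10^ℕ`. -/
def unit (n : ℕ) : Cantor := fun i => decide (i = n)

theorem tag_inj {n m : ℕ} {p q : Cantor} (h : tag n p = tag m q) : n = m ∧ p = q := by
  have hnm : n = m := by
    rcases lt_trichotomy n m with hlt | heq | hlt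
    · have := congrFun h n
      simp [tag, hlt] at this
    · exact heq
    · have := congrFun h m
      simp [tag, hlt] at this
  subst hnm
  refine ⟨rfl, funext fun i => ?_⟩
  have h1 := congrFun h (n + i + 1)
  have h2 : ¬ n + i + 1 < n := by omega
  have h3 : ¬ n + i + 1 = n := by omega
  have h4 : n + i + 1 - n - 1 = i := by omega
  simpa [tag, h2, h3, h4] using h1

theorem unit_inj {n m : ℕ} (h : unit n = unit m) : n = m := by
  have := congrFun h n
  simpa [unit] using this

end Cantor

namespace TypeTwo

open Nat.Partrec (Code)

/-- The reaction of a machine with program `c` that has to produce the output symbol number `k` and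
has so far read the first `m` symbols of its infinite input `p`. The value `0` means that the
machine goes on to read one more input symbol, the value `1` that it outputs the symbol `0`, any
other value that it outputs the symbol `1`. Divergence means that the machine hangs. -/
def reaction (c : Code) (p : Cantor) (k m : ℕ) : Part ℕ :=
  c.eval (Nat.pair (Encodable.encode (List.ofFn fun i : Fin m => p i)) k)

/-- Whether the machine, having read the first `m` input symbols, outputs symbol number `k` rather
than reading on. -/
def answers (c : Code) (p : Cantor) (k : ℕ) : ℕ →. Bool :=
  fun m => (reaction c p k m).map fun v => decide (v ≠ 0)

/-- Output symbol number `k` of the machine with program `c` on the infinite input `p`: the machine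
reads input symbols until it reacts with an output. -/
def outputBit (c : Code) (p : Cantor) (k : ℕ) : Part Bool :=
  (Nat.rfind (answers c p k)).bind fun m =>
    (reaction c p k m).map fun v => decide (v ≠ 1)

/-- The partial function `⊆ {0,1}^ℕ → {0,1}^ℕ` computed by the program `c`. It is defined at `p`
iff every output symbol is eventually produced. -/
def run (c : Code) : Cantor →. Cantor := fun p =>
  ⟨∀ k, (outputBit c p k).Dom, fun h k => (outputBit c p k).get (h k)⟩

/-- The partial function computed by the `n`-th machine equipped with the oracle `o`. -/
def runOracle (n : ℕ) (o : Cantor) : Cantor →. Cantor := fun p =>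
  run (Denumerable.ofNat Code n) (Cantor.pair o p)

/-- Computable partial functions on Cantor space. -/
def ComputableFun (F : Cantor →. Cantor) : Prop := ∃ c : Code, F = run c

/-- Continuous partial functions on Cantor space (continuous on their domain, which carries the
subspace topology). -/
def ContinuousFun (F : Cantor →. Cantor) : Prop := Continuous F.asSubtype

end TypeTwo

/-! ### Represented spaces -/

/-- A represented space: a set `carrier` with a partial surjection `δ : ⊆ {0,1}^ℕ → carrier`, given
by its graph `IsName p x ↔ δ(p) = x`. -/
structure RepresentedSpace where
  carrier : Type*
  IsName : Cantor → carrier → Prop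
  unique : ∀ {p x y}, IsName p x → IsName p y → x = y
  surjective : ∀ x, ∃ p, IsName p x

namespace RepresentedSpace

instance : CoeSort RepresentedSpace.{u} (Type u) := ⟨carrier⟩

/-- `F` is a realizer of the partial multi-valued function `f` with domain `D`: whenever `p` is a
name of some `x ∈ D`, then `F(p)` is defined and is a name of some element of `f(x)`. -/
def IsRealizer {X : RepresentedSpace.{u}} {Y : RepresentedSpace.{v}} (F : Cantor →. Cantor)
    (D : Set X) (f : X → Set Y) : Prop :=
  ∀ p x, X.IsName p x → x ∈ D → ∃ q ∈ F p, ∃ y ∈ f x, Y.IsName q y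

/-- The partial multi-valued function `f` with domain `D` is continuous. -/
def ContinuousMulti {X : RepresentedSpace.{u}} {Y : RepresentedSpace.{v}}
    (D : Set X) (f : X → Set Y) : Prop :=
  ∃ F, TypeTwo.ContinuousFun F ∧ IsRealizer F D f

/-- The partial multi-valued function `f` with domain `D` is computable. -/
def ComputableMulti {X : RepresentedSpace.{u}} {Y : RepresentedSpace.{v}}
    (D : Set X) (f : X → Set Y) : Prop :=
  ∃ F, TypeTwo.ComputableFun F ∧ IsRealizer F D f

/-- The (total, single-valued) map `f` is continuous. -/
def ContinuousMap {X : RepresentedSpace.{u}} {Y : RepresentedSpace.{v}} (f : X → Y) : Prop :=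
  ContinuousMulti Set.univ fun x => {f x}

/-- The (total, single-valued) map `f` is computable. -/
def ComputableMap {X : RepresentedSpace.{u}} {Y : RepresentedSpace.{v}} (f : X → Y) : Prop :=
  ComputableMulti Set.univ fun x => {f x}

/-- A computable point: one that has a computable name. -/
def ComputablePoint {X : RepresentedSpace.{u}} (x : X) : Prop :=
  ∃ p : Cantor, Computable p ∧ X.IsName p x

/-- The represented space `ℕ`, where `0ⁿ10^ℕ` is the name of `n`. -/
def nat : RepresentedSpace.{0} where
  carrier := ℕ
  IsName p n := p = Cantor.unit n
  unique h h' := Cantor.unit_inj (h.symm.trans h')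
  surjective n := ⟨Cantor.unit n, rfl⟩

/-- The Sierpiński space `𝕊 = {⊥, ⊤}`, with `⊥ = False` and `⊤ = True` in `Prop`: the only name of
`⊥` is `0^ℕ`, and every other sequence is a name of `⊤`. -/
def sierpinski : RepresentedSpace.{0} where
  carrier := Prop
  IsName p s := s ↔ ∃ i, p i = true
  unique h h' := propext (h.trans h'.symm)
  surjective s := by
    by_cases h : s
    · exact ⟨fun _ => true, by simp [h]⟩
    · exact ⟨fun _ => false, by simp [h]⟩

/-- The product `X × Y`, where `⟨p, q⟩` is a name of `(x, y)` iff `p` names `x` and `q` names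
`y`. -/
def prod (X : RepresentedSpace.{u}) (Y : RepresentedSpace.{v}) : RepresentedSpace.{max u v} where
  carrier := X × Y
  IsName r z := X.IsName r.fst z.1 ∧ Y.IsName r.snd z.2
  unique h h' := Prod.ext (X.unique h.1 h'.1) (Y.unique h.2 h'.2)
  surjective z := by
    obtain ⟨p, hp⟩ := X.surjective z.1
    obtain ⟨q, hq⟩ := Y.surjective z.2
    have h1 : (Cantor.pair p q).fst = p := by
      funext i
      simp [Cantor.pair, Cantor.fst]
    have h2 : (Cantor.pair p q).snd = q := by
      funext i
      have e1 : (2 * i + 1) % 2 = 1 := by omega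
      have e2 : (2 * i + 1) / 2 = i := by omega
      simp [Cantor.pair, Cantor.snd, e1, e2]
    exact ⟨Cantor.pair p q, by rw [h1]; exact hp, by rw [h2]; exact hq⟩

/-- The subspace of `X` on the set `A`: the names of its points are their names in `X`. -/
def subspace (X : RepresentedSpace.{u}) (A : Set X) : RepresentedSpace.{u} where
  carrier := A
  IsName p x := X.IsName p x.1
  unique h h' := Subtype.ext (X.unique h h')
  surjective x := X.surjective x.1

/-- `q` is a `[δ_X → δ_Y]`-name of `f`: it has the form `0ⁿ1o`, and the `n`-th machine equipped with
the oracle `o` computes a realizer of `f`. -/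
def IsFunName {X : RepresentedSpace.{u}} {Y : RepresentedSpace.{v}}
    (q : Cantor) (f : X → Y) : Prop :=
  ∃ n o, q = Cantor.tag n o ∧
    IsRealizer (TypeTwo.runOracle n o) (Set.univ : Set X) fun x => ({f x} : Set Y)

theorem IsFunName.unique {X : RepresentedSpace.{u}} {Y : RepresentedSpace.{v}}
    {q : Cantor} {f g : X → Y} (hf : IsFunName q f) (hg : IsFunName q g) : f = g := by
  obtain ⟨n, o, rfl, hf⟩ := hf
  obtain ⟨m, o', h, hg⟩ := hg
  obtain ⟨rfl, rfl⟩ := Cantor.tag_inj h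
  funext x
  obtain ⟨p, hp⟩ := X.surjective x
  obtain ⟨r, hr, y, hy, hry⟩ := hf p x hp (Set.mem_univ x)
  obtain ⟨r', hr', y', hy', hry'⟩ := hg p x hp (Set.mem_univ x)
  obtain rfl := Part.mem_unique hr hr'
  rw [Set.mem_singleton_iff] at hy hy'
  rw [← hy, ← hy']
  exact Y.unique hry hry'

/-- The space `C(X, Y)` of the functions from `X` to `Y` that have a `[δ_X → δ_Y]`-name. -/
def functions (X : RepresentedSpace.{u}) (Y : RepresentedSpace.{v}) :
    RepresentedSpace.{max u v} where
  carrier := {f : X → Y // ∃ q, IsFunName q f}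
  IsName q f := IsFunName q f.1
  unique h h' := Subtype.ext (h.unique h')
  surjective f := f.2

/-- The space `O(X)` of open sets: `U` is identified with the `f ∈ C(X, 𝕊)` with
`f⁻¹{⊤} = U`. -/
def opens (X : RepresentedSpace.{u}) : RepresentedSpace.{u} where
  carrier := {U : Set X // ∃ q, IsFunName (Y := sierpinski) q fun x => x ∈ U}
  IsName q U := IsFunName (Y := sierpinski) q fun x => x ∈ U.1
  unique h h' := Subtype.ext (Set.ext fun x => iff_of_eq (congrFun (h.unique h') x))
  surjective U := U.2

/-- The space `A(X)` of closed sets: `A` is identified with the `f ∈ C(X, 𝕊)` with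
`f⁻¹{⊥} = A`. -/
def closeds (X : RepresentedSpace.{u}) : RepresentedSpace.{u} where
  carrier := {A : Set X // ∃ q, IsFunName (Y := sierpinski) q fun x => x ∉ A}
  IsName q A := IsFunName (Y := sierpinski) q fun x => x ∉ A.1
  unique h h' := Subtype.ext (Set.ext fun x => not_iff_not.1 (iff_of_eq (congrFun (h.unique h') x)))
  surjective A := A.2

/-! ### The maps that characterize compactness -/

/-- `IsEmpty : A(X) → 𝕊`, with value `⊤` exactly at `∅`. -/
def isEmpty (X : RepresentedSpace.{u}) : X.closeds → sierpinski := fun A => A.1 = ∅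

/-- `IsFull : O(X) → 𝕊`, with value `⊤` exactly at `X`. -/
def isFull (X : RepresentedSpace.{u}) : X.opens → sierpinski := fun U => U.1 = Set.univ

/-- `⊆ : A(X) × O(X) → 𝕊`, with value `⊤` at `(A, U)` iff `A ⊆ U`. -/
def subsetMap (X : RepresentedSpace.{u}) : X.closeds.prod X.opens → sierpinski :=
  fun z => z.1.1 ⊆ z.2.1

/-- `IsCover : C(ℕ, O(X)) → 𝕊`, with value `⊤` at `(U_n)` iff `⋃ U_n = X`. -/
def isCover (X : RepresentedSpace.{u}) : nat.functions X.opens → sierpinski :=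
  fun U => (⋃ n : ℕ, (U.1 n).1) = Set.univ

/-- The domain of `FiniteSubcover`: the sequences of open sets that cover `X`. -/
def finiteSubcoverDom (X : RepresentedSpace.{u}) : Set (nat.functions X.opens) :=
  {U | (⋃ n : ℕ, (U.1 n).1) = Set.univ}

/-- `FiniteSubcover : ⊆ C(ℕ, O(X)) ⇉ ℕ`, with the values `N` such that `U_0 ∪ … ∪ U_N = X`. -/
def finiteSubcover (X : RepresentedSpace.{u}) : nat.functions X.opens → Set nat :=
  fun U => {N : ℕ | (⋃ n : ℕ, ⋃ _ : n ≤ N, (U.1 n).1) = Set.univ}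

/-- The domain of `Enough`: the sequences of closed sets with empty intersection. -/
def enoughDom (X : RepresentedSpace.{u}) : Set (nat.functions X.closeds) :=
  {A | (⋂ n : ℕ, (A.1 n).1) = ∅}

/-- `Enough : ⊆ C(ℕ, A(X)) ⇉ ℕ`, with the values `N` such that `A_0 ∩ … ∩ A_N = ∅`. -/
def enough (X : RepresentedSpace.{u}) : nat.functions X.closeds → Set nat :=
  fun A => {N : ℕ | (⋂ n : ℕ, ⋂ _ : n ≤ N, (A.1 n).1) = ∅}

/-- `π₂ : A(X × Y) → A(Y)`, as a multi-valued function: its only possible value at `A` is the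
projection of `A` to `Y`, and there is such a value iff this projection is a member of `A(Y)`. A
realizer with domain `A(X × Y)` thus exists only if all projections are members of `A(Y)`. -/
def projection (X : RepresentedSpace.{u}) (Y : RepresentedSpace.{v}) :
    (X.prod Y).closeds → Set Y.closeds :=
  fun A => {B | B.1 = {y : Y | ∃ x : X, ((x, y) : X × Y) ∈ A.1}}

/-- Compactness: `IsEmpty` is continuous. -/
def IsCompactSpace (X : RepresentedSpace.{u}) : Prop := ContinuousMap X.isEmpty

/-- Computable compactness: `IsEmpty` is computable. -/
def IsComputablyCompactSpace (X : RepresentedSpace.{u}) : Prop := ComputableMap X.isEmpty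

end RepresentedSpace

-- Both readings are instances of one relativized statement. `OracleMulti K` asks for a realizer
-- computed by a machine with an oracle from `K`. If `K` contains all sequences this is continuity
-- (`continuousMulti_iff`): an oracle can list which finite input prefixes determine which output
-- symbols. If `K` consists of the computable sequences it is computability (`computableMulti_iff`).
-- The equivalences need only that `K` contains the computable sequences and is closed under pairing
-- (`tfae_compact`).
--
-- Each of the nine properties is shown equivalent to `FullSemi K X`: fullness of an open set can be
-- semidecided from its names. For emptiness, inclusion, covers and closed subspaces this is a
-- translation of names by complements, unions and constant sequences. For projections, `y` lies
-- outside the projection of `A` iff the open slice `{x | (x, y) ∉ A}` is full; conversely `U = X`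
-- iff a fixed point of `Y` lies outside the projection of `Uᶜ × Y`.
--
-- The finite subcover property rests on finite use of the input. A test that accepts a name of the
-- whole union has read only finitely much of it, hence also accepts a name that agrees so far but
-- describes a finite union. Conversely, if a machine answers `N` on the constant sequence `U`, the
-- sequence may be changed to `X` at late indices without affecting the answer; the modified
-- sequence does cover, so `N` is correct for it, and its first `N + 1` members are still `U`.
--
-- Machines are not programmed directly. `Semi` describes effectively open predicates and is closed
-- under the logical operations and substitution; `semi_outputBit` (a universal machine) and
-- `exists_code_of_semi` translate between the two. Uniform names come from `exists_openName` and
-- `exists_seqName`.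

attribute [fun_prop] Primrec

attribute [fun_prop] Primrec.id Primrec.const Primrec.comp Primrec.fst Primrec.snd Primrec.pair
  Primrec.succ Primrec.encode Primrec.unpair

namespace TypeTwo

/-! ### Closure properties of primitive recursive functions and predicates -/

section Primrec

variable {α β σ : Type*} [Primcodable α] [Primcodable β] [Primcodable σ]

@[fun_prop]
theorem primrec_add {f g : α → ℕ} (hf : Primrec f) (hg : Primrec g) :
    Primrec fun a => f a + g a := Primrec.nat_add.comp hf hg

@[fun_prop]
theorem primrec_sub {f g : α → ℕ} (hf : Primrec f) (hg : Primrec g) :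
    Primrec fun a => f a - g a := Primrec.nat_sub.comp hf hg

@[fun_prop]
theorem primrec_mul {f g : α → ℕ} (hf : Primrec f) (hg : Primrec g) :
    Primrec fun a => f a * g a := Primrec.nat_mul.comp hf hg

@[fun_prop]
theorem primrec_div {f g : α → ℕ} (hf : Primrec f) (hg : Primrec g) :
    Primrec fun a => f a / g a := Primrec.nat_div.comp hf hg

@[fun_prop]
theorem primrec_mod {f g : α → ℕ} (hf : Primrec f) (hg : Primrec g) :
    Primrec fun a => f a % g a := Primrec.nat_mod.comp hf hg

@[fun_prop]
theorem primrec_natPair {f g : α → ℕ} (hf : Primrec f) (hg : Primrec g) :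
    Primrec fun a => Nat.pair (f a) (g a) := Primrec₂.natPair.comp hf hg

@[fun_prop]
theorem primrec_length {f : α → List β} (hf : Primrec f) :
    Primrec fun a => (f a).length := Primrec.list_length.comp hf

@[fun_prop]
theorem primrec_take {f : α → ℕ} {g : α → List β} (hf : Primrec f) (hg : Primrec g) :
    Primrec fun a => (g a).take (f a) := Primrec.list_take.comp hf hg

@[fun_prop]
theorem primrec_getElem? {f : α → ℕ} {g : α → List β} (hf : Primrec f) (hg : Primrec g) :
    Primrec fun a => (g a)[f a]? := Primrec.list_getElem?.comp hg hf

@[fun_prop]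
theorem primrec_some {f : α → β} (hf : Primrec f) :
    Primrec fun a => some (f a) := Primrec.option_some.comp hf

@[fun_prop]
theorem primrec_evaln {t : α → ℕ} {c : α → Nat.Partrec.Code} {n : α → ℕ}
    (ht : Primrec t) (hc : Primrec c) (hn : Primrec n) :
    Primrec fun a => (c a).evaln (t a) (n a) :=
  Nat.Partrec.Code.primrec_evaln.comp ((ht.pair hc).pair hn)

theorem primrecPred_eq {f g : α → β} (hf : Primrec f) (hg : Primrec g) :
    PrimrecPred fun a => f a = g a := Primrec.eq.comp hf hg

theorem primrecPred_lt {f g : α → ℕ} (hf : Primrec f) (hg : Primrec g) :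
    PrimrecPred fun a => f a < g a := Primrec.nat_lt.comp hf hg

theorem primrecPred_exists_lt {f : α → ℕ} {R : ℕ → α → Prop}
    (hR : PrimrecPred fun x : ℕ × α => R x.1 x.2) (hf : Primrec f) :
    PrimrecPred fun a => ∃ i < f a, R i a :=
  ((PrimrecRel.exists_mem_list (R := R) hR).comp (Primrec.list_range.comp hf) Primrec.id).of_eq
    (by simp)

theorem primrecPred_forall_lt {f : α → ℕ} {R : ℕ → α → Prop}
    (hR : PrimrecPred fun x : ℕ × α => R x.1 x.2) (hf : Primrec f) :
    PrimrecPred fun a => ∀ i < f a, R i a :=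
  ((PrimrecRel.forall_mem_list (R := R) hR).comp (Primrec.list_range.comp hf) Primrec.id).of_eq
    (by simp)

theorem primrecPred_exists_decode {R : β → α → Prop}
    (hR : PrimrecPred fun x : β × α => R x.1 x.2) :
    PrimrecPred fun x : ℕ × α => ∃ b ∈ (Encodable.decode x.1 : Option β), R b x.2 := by
  classical
  replace hR := hR.decide
  have h : Primrec fun x : ℕ × α =>
      ((Encodable.decode x.1 : Option β).map fun b => decide (R b x.2)) :=
    Primrec.option_map (Primrec.decode.comp Primrec.fst)
      (hR.comp (Primrec.snd.pair (Primrec.snd.comp Primrec.fst))).to₂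
  refine (primrecPred_eq h (Primrec.const (some true))).of_eq fun x => ?_
  simp [Option.map_eq_some_iff]

end Primrec

/-! ### Finite prefixes -/

/-- The list of the first `m` symbols of `p`. -/
def pre (p : Cantor) (m : ℕ) : List Bool := List.ofFn fun i : Fin m => p i

@[simp]
theorem length_pre (p : Cantor) (m : ℕ) : (pre p m).length = m := by simp [pre]

theorem getElem?_pre (p : Cantor) (m i : ℕ) :
    (pre p m)[i]? = if i < m then some (p i) else none := by
  by_cases h : i < m <;> simp [pre, h]

theorem take_pre (p : Cantor) {k m : ℕ} (h : k ≤ m) : (pre p m).take k = pre p k := by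
  apply List.ext_getElem?
  intro i
  rw [List.getElem?_take, getElem?_pre, getElem?_pre]
  split_ifs <;> first | rfl | omega

theorem pre_eq_pre_iff {p q : Cantor} {m : ℕ} : pre p m = pre q m ↔ ∀ i < m, p i = q i := by
  constructor
  · intro h i hi
    have := congrArg (fun l : List Bool => l[i]?) h
    simp only [getElem?_pre, if_pos hi] at this
    exact Option.some_injective _ this
  · intro h
    exact congrArg List.ofFn (funext fun i : Fin m => h i i.2)

/-! ### Effectively open predicates -/

/-- A predicate on `{0,1}^ℕ × α`, for a discrete `α`, that is effectively open: it is verified by a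
primitive recursive check of finite prefixes of the first argument. -/
def Semi {α : Type*} [Primcodable α] (W : Cantor → α → Prop) : Prop :=
  ∃ Q : List Bool → α → Prop, (PrimrecPred fun x : List Bool × α => Q x.1 x.2) ∧
    (∀ p a m m', m ≤ m' → Q (pre p m) a → Q (pre p m') a) ∧
    ∀ p a, W p a ↔ ∃ m, Q (pre p m) a

namespace Semi

variable {α β : Type*} [Primcodable α] [Primcodable β]

theorem of_eq {W W' : Cantor → α → Prop} (h : Semi W) (e : ∀ p a, W p a ↔ W' p a) : Semi W' := by
  have : W = W' := by
    ext p a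
    exact e p a
  exact this ▸ h

/-- Monotonicity of the check costs nothing: let it succeed as soon as `Q` holds for some initial
segment of the given prefix. -/
theorem of_prefix {Q : List Bool → α → Prop}
    (hQ : PrimrecPred fun x : List Bool × α => Q x.1 x.2) :
    Semi fun p a => ∃ m, Q (pre p m) a := by
  refine ⟨fun l a => ∃ k < l.length + 1, Q (l.take k) a, ?_, ?_, ?_⟩
  · refine primrecPred_exists_lt (R := fun k (x : List Bool × α) => Q (x.1.take k) x.2) ?_
      (by fun_prop)
    exact hQ.comp (f := fun x : ℕ × List Bool × α => (x.2.1.take x.1, x.2.2)) (by fun_prop)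
  · rintro p a m m' h ⟨k, hk, hQ⟩
    rw [length_pre] at hk
    rw [take_pre p (by omega)] at hQ
    exact ⟨k, by rw [length_pre]; omega, by rwa [take_pre p (by omega)]⟩
  · intro p a
    constructor
    · rintro ⟨m, h⟩
      exact ⟨m, m, by simp, by rwa [take_pre p le_rfl]⟩
    · rintro ⟨m, k, hk, h⟩
      rw [length_pre] at hk
      exact ⟨k, by rwa [take_pre p (by omega)] at h⟩

theorem of_pre {Q : List Bool → α → Prop}
    (hQ : PrimrecPred fun x : List Bool × α => Q x.1 x.2) {f : α → ℕ} (hf : Primrec f) :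
    Semi fun p a => Q (pre p (f a)) a := by
  refine (of_prefix (Q := fun l a => l.length = f a ∧ Q l a)
    ((primrecPred_eq (by fun_prop) (by fun_prop)).and hQ)).of_eq fun p a => ?_
  simp

theorem of_primrecPred {P : α → Prop} (hP : PrimrecPred P) : Semi fun _ a => P a :=
  of_pre (Q := fun _ a => P a) (f := fun _ => 0) (hP.comp Primrec.snd) (by fun_prop)

theorem bit {f : α → ℕ} (hf : Primrec f) {g : α → Bool} (hg : Primrec g) :
    Semi fun p a => p (f a) = g a := by
  refine (of_pre (Q := fun l a => l[f a]? = some (g a)) (f := fun a => f a + 1)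
    (primrecPred_eq (by fun_prop) (by fun_prop)) (by fun_prop)).of_eq fun p a => ?_
  simp only [getElem?_pre, if_pos (Nat.lt_succ_self _), Option.some_inj]

theorem comp {W : Cantor → α → Prop} (h : Semi W) {f : β → α} (hf : Primrec f) :
    Semi fun p b => W p (f b) := by
  obtain ⟨Q, hQ, hm, hW⟩ := h
  exact ⟨fun l b => Q l (f b),
    hQ.comp (f := fun x : List Bool × β => (x.1, f x.2)) (by fun_prop),
    fun p b => hm p (f b), fun p b => hW p (f b)⟩

theorem and {V W : Cantor → α → Prop} (hV : Semi V) (hW : Semi W) :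
    Semi fun p a => V p a ∧ W p a := by
  obtain ⟨Q, hQ, hm, hV⟩ := hV
  obtain ⟨R, hR, hn, hW⟩ := hW
  refine ⟨fun l a => Q l a ∧ R l a, hQ.and hR,
    fun p a m m' h => And.imp (hm p a m m' h) (hn p a m m' h), fun p a => ?_⟩
  simp only [hV, hW]
  constructor
  · rintro ⟨⟨m, h⟩, n, h'⟩
    exact ⟨max m n, hm p a _ _ (le_max_left _ _) h, hn p a _ _ (le_max_right _ _) h'⟩
  · rintro ⟨m, h, h'⟩
    exact ⟨⟨m, h⟩, m, h'⟩

theorem or {V W : Cantor → α → Prop} (hV : Semi V) (hW : Semi W) :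
    Semi fun p a => V p a ∨ W p a := by
  obtain ⟨Q, hQ, hm, hV⟩ := hV
  obtain ⟨R, hR, hn, hW⟩ := hW
  refine ⟨fun l a => Q l a ∨ R l a, hQ.or hR,
    fun p a m m' h => Or.imp (hm p a m m' h) (hn p a m m' h), fun p a => ?_⟩
  simp only [hV, hW, exists_or]

/-- The prefix length doubles as a search bound for the code of the witness, so the unbounded search
becomes a primitive recursive check. -/
theorem exists_ {W : Cantor → α → β → Prop} (h : Semi fun p (x : α × β) => W p x.1 x.2) :
    Semi fun p a => ∃ b, W p a b := by
  obtain ⟨Q, hQ, hm, hW⟩ := h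
  replace hW : ∀ p a b, W p a b ↔ ∃ m, Q (pre p m) (a, b) := fun p a b => hW p (a, b)
  refine ⟨fun l a => ∃ n < l.length, ∃ b ∈ (Encodable.decode n : Option β), Q l (a, b),
    ?_, ?_, ?_⟩
  · refine primrecPred_exists_lt (R := fun n (x : List Bool × α) =>
      ∃ b ∈ (Encodable.decode n : Option β), Q x.1 (x.2, b)) ?_ (by fun_prop)
    exact primrecPred_exists_decode (R := fun b (x : List Bool × α) => Q x.1 (x.2, b))
      (hQ.comp (f := fun x : β × List Bool × α => (x.2.1, (x.2.2, x.1))) (by fun_prop))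
  · rintro p a m m' h ⟨n, hn, b, hb, hQ⟩
    rw [length_pre] at hn
    exact ⟨n, by rw [length_pre]; omega, b, hb, hm _ _ _ _ h hQ⟩
  · intro p a
    constructor
    · rintro ⟨b, h⟩
      obtain ⟨m, h⟩ := (hW p a b).1 h
      exact ⟨max m (Encodable.encode b + 1), Encodable.encode b, by simp,
        b, by simp, hm p _ _ _ (le_max_left _ _) h⟩
    · rintro ⟨m, _, _, b, _, h⟩
      exact ⟨b, (hW p a b).2 ⟨m, h⟩⟩

/-- Finitely many conditions need finitely many prefixes; by monotonicity the longest serves for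
all. -/
theorem forall_lt {W : Cantor → α → ℕ → Prop} (h : Semi fun p (x : α × ℕ) => W p x.1 x.2)
    {f : α → ℕ} (hf : Primrec f) : Semi fun p a => ∀ i < f a, W p a i := by
  obtain ⟨Q, hQ, hm, hW⟩ := h
  replace hW : ∀ p a i, W p a i ↔ ∃ m, Q (pre p m) (a, i) := fun p a i => hW p (a, i)
  refine ⟨fun l a => ∀ i < f a, Q l (a, i), ?_, ?_, ?_⟩
  · exact primrecPred_forall_lt (R := fun i (x : List Bool × α) => Q x.1 (x.2, i))
      (hQ.comp (f := fun x : ℕ × List Bool × α => (x.2.1, (x.2.2, x.1))) (by fun_prop))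
      (by fun_prop)
  · intro p a m m' h H i hi
    exact hm _ _ _ _ h (H i hi)
  · intro p a
    constructor
    · intro H
      choose! m hm' using fun i hi => (hW p a i).1 (H i hi)
      exact ⟨(Finset.range (f a)).sup m, fun i hi =>
        hm _ _ _ _ (Finset.le_sup (Finset.mem_range.2 hi)) (hm' i hi)⟩
    · rintro ⟨m, H⟩ i hi
      exact (hW p a i).2 ⟨m, H i hi⟩

/-- An effectively open predicate depends on finitely many symbols of its argument. -/
theorem exists_modulus {W : Cantor → α → Prop} (h : Semi W) {p : Cantor} {a : α} (hp : W p a) :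
    ∃ m, ∀ q : Cantor, (∀ i < m, p i = q i) → W q a := by
  obtain ⟨Q, hQ, hm, hW⟩ := h
  obtain ⟨m, h⟩ := (hW p a).1 hp
  exact ⟨m, fun q hq => (hW q a).2 ⟨m, pre_eq_pre_iff.2 hq ▸ h⟩⟩

end Semi

end TypeTwo

/-! ### Decoding pairs and tagged sequences -/

namespace Cantor

@[simp]
theorem fst_pair (p q : Cantor) : (pair p q).fst = p := by
  funext i
  simp [pair, fst]

@[simp]
theorem snd_pair (p q : Cantor) : (pair p q).snd = q := by
  funext i
  have e1 : (2 * i + 1) % 2 = 1 := by omega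
  have e2 : (2 * i + 1) / 2 = i := by omega
  simp [pair, snd, e1, e2]

theorem unit_self (n : ℕ) : unit n n = true := by simp [unit]

/-- The sequence `p(n) p(n+1) p(n+2) …`. -/
def drop (n : ℕ) (p : Cantor) : Cantor := fun i => p (n + i)

@[simp]
theorem drop_tag (n : ℕ) (p : Cantor) : drop (n + 1) (tag n p) = p := by
  funext i
  have h1 : ¬ n + 1 + i < n := by omega
  have h2 : ¬ n + 1 + i = n := by omega
  have h3 : n + 1 + i - n - 1 = i := by omega
  simp [drop, tag, h1, h2, h3]

theorem tag_drop {n : ℕ} {q : Cantor} (h : q n = true) (h' : ∀ i < n, q i = false) :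
    tag n (drop (n + 1) q) = q := by
  funext i
  rcases lt_trichotomy i n with hi | rfl | hi
  · simp [tag, hi, h' i hi]
  · simp [tag, h]
  · have h1 : ¬ i < n := by omega
    have h2 : ¬ i = n := by omega
    have h3 : n + 1 + (i - n - 1) = i := by omega
    simp [drop, tag, h1, h2, h3]

end Cantor

namespace TypeTwo

open Nat.Partrec (Code)
open Cantor (pair tag unit drop)

variable {α β : Type*} [Primcodable α] [Primcodable β]

/-! ### Machines and effectively open graphs -/

theorem mem_outputBit {c : Code} {p : Cantor} {k : ℕ} {b : Bool} :
    b ∈ outputBit c p k ↔ ∃ m v, (∀ i < m, 0 ∈ reaction c p k i) ∧ v ∈ reaction c p k m ∧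
      v ≠ 0 ∧ b = decide (v ≠ 1) := by
  simp only [outputBit, Part.mem_bind_iff, Nat.mem_rfind, answers, Part.mem_map_iff]
  constructor
  · rintro ⟨m, ⟨⟨v, hv, hv0⟩, h⟩, v', hv', rfl⟩
    obtain rfl := Part.mem_unique hv hv'
    refine ⟨m, v, fun i hi => ?_, hv, by simpa using hv0, rfl⟩
    obtain ⟨w, hw, hw0⟩ := h hi
    obtain rfl : w = 0 := by simpa using hw0
    exact hw
  · rintro ⟨m, v, h, hv, hv0, rfl⟩
    exact ⟨m, ⟨⟨v, hv, by simpa using hv0⟩, fun {i} hi => ⟨0, h i hi, by simp⟩⟩, v, hv, rfl⟩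

theorem mem_run {c : Code} {p q : Cantor} : q ∈ run c p ↔ ∀ k, q k ∈ outputBit c p k := by
  constructor
  · rintro ⟨h, rfl⟩ k
    exact Part.get_mem (h k)
  · intro h
    have hd := fun k => Part.dom_iff_mem.2 ⟨_, h k⟩
    exact ⟨hd, funext fun k => Part.get_eq_of_mem (h k) (hd k)⟩

theorem semi_reaction : Semi fun p (x : Code × ℕ × ℕ × ℕ) =>
    x.2.2.2 ∈ reaction x.1 p x.2.1 x.2.2.1 := by
  have h : Semi fun p (x : (Code × ℕ × ℕ × ℕ) × ℕ) =>
      x.1.1.evaln x.2 (Nat.pair (Encodable.encode (pre p x.1.2.2.1)) x.1.2.1) =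
        some x.1.2.2.2 :=
    Semi.of_pre (Q := fun l (x : (Code × ℕ × ℕ × ℕ) × ℕ) =>
      x.1.1.evaln x.2 (Nat.pair (Encodable.encode l) x.1.2.1) = some x.1.2.2.2)
      (f := fun x => x.1.2.2.1) (primrecPred_eq (by fun_prop) (by fun_prop)) (by fun_prop)
  refine (Semi.exists_ (W := fun p (x : Code × ℕ × ℕ × ℕ) t =>
    x.1.evaln t (Nat.pair (Encodable.encode (pre p x.2.2.1)) x.2.1) = some x.2.2.2) h).of_eq
    fun p x => ?_
  rw [reaction, Code.evaln_complete]
  rfl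

/-- The universal machine: the output symbols are effectively open in the input. -/
theorem semi_outputBit : Semi fun p (x : Code × ℕ × Bool) => x.2.2 ∈ outputBit x.1 p x.2.1 := by
  simp only [mem_outputBit]
  refine Semi.exists_ (Semi.exists_ (Semi.and ?_ (Semi.and ?_ (Semi.of_primrecPred ?_))))
  · refine Semi.forall_lt (f := fun x : ((Code × ℕ × Bool) × ℕ) × ℕ => x.1.2) ?_ (by fun_prop)
    exact semi_reaction.comp
      (f := fun x : (((Code × ℕ × Bool) × ℕ) × ℕ) × ℕ => (x.1.1.1.1, x.1.1.1.2.1, x.2, 0))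
      (by fun_prop)
  · exact semi_reaction.comp
      (f := fun x : ((Code × ℕ × Bool) × ℕ) × ℕ => (x.1.1.1, x.1.1.2.1, x.1.2, x.2))
      (by fun_prop)
  · refine (primrecPred_eq (by fun_prop) (by fun_prop)).not.and
      (primrecPred_eq (by fun_prop) ?_)
    exact (primrecPred_eq (α := ((Code × ℕ × Bool) × ℕ) × ℕ) (f := fun x => x.2) (g := fun _ => 1)
      (by fun_prop) (by fun_prop)).not.decide

/-- Effectively open graphs are computed by machines. -/
theorem exists_code_of_semi {G : Cantor → ℕ × Bool → Prop} (hG : Semi G) :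
    ∃ c : Code, ∀ p q : Cantor, (∀ k, G p (k, q k)) → (∀ k b, G p (k, b) → q k = b) →
      q ∈ run c p := by
  classical
  obtain ⟨Q, hQ, -, hG⟩ := hG
  -- The values follow the convention of `reaction`: `2` outputs the symbol `1`, `1` outputs the
  -- symbol `0`, and `0` reads on.
  let g : List Bool × ℕ → ℕ := fun x =>
    if Q x.1 (x.2, true) then 2 else if Q x.1 (x.2, false) then 1 else 0
  have hg : Primrec g :=
    Primrec.ite (hQ.comp (f := fun x : List Bool × ℕ => (x.1, (x.2, true))) (by fun_prop))
      (by fun_prop)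
      (Primrec.ite (hQ.comp (f := fun x : List Bool × ℕ => (x.1, (x.2, false))) (by fun_prop))
        (by fun_prop) (by fun_prop))
  obtain ⟨c, hc⟩ := Code.exists_code.1 hg.to_comp
  have he : ∀ x, c.eval (Encodable.encode x) = Part.some (g x) := by
    intro x
    rw [hc]
    simp only [Encodable.encodek, Part.coe_some, Part.bind_some, PFun.coe_val, Part.map_some,
      Encodable.encode_nat]
  have hr : ∀ p k m, reaction c p k m = Part.some (g (pre p m, k)) := fun p k m => he (pre p m, k)
  refine ⟨c, fun p q h h' => mem_run.2 fun k => ?_⟩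
  have hex : ∃ m, g (pre p m, k) ≠ 0 := by
    obtain ⟨m, hm⟩ := (hG _ _).1 (h k)
    refine ⟨m, ?_⟩
    cases hq : q k <;> rw [hq] at hm <;> simp only [g]
    · simp only [hm, if_true]
      split_ifs <;> simp
    · simp [hm]
  refine mem_outputBit.2 ⟨Nat.find hex, g (pre p (Nat.find hex), k), fun i hi => ?_, ?_,
    Nat.find_spec hex, ?_⟩
  · rw [hr, Part.mem_some_iff]
    exact (not_not.1 (Nat.find_min hex hi)).symm
  · rw [hr]
    exact Part.mem_some _
  · have hs := Nat.find_spec hex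
    generalize Nat.find hex = m at hs
    simp only [g] at hs ⊢
    split_ifs at hs ⊢ with h1 h2
    · simpa using h' k true ((hG _ _).2 ⟨m, h1⟩)
    · simpa using h' k false ((hG _ _).2 ⟨m, h2⟩)
    · exact absurd rfl hs

theorem run_singleValued {c : Code} {p q : Cantor} (h : q ∈ run c p) (k : ℕ) (b : Bool) :
    b ∈ outputBit c p k ↔ q k = b :=
  ⟨fun hb => Part.mem_unique (mem_run.1 h k) hb, fun hb => hb ▸ mem_run.1 h k⟩

/-! ### Substitution -/

/-- Guess a finite list, verify with `G` that it is a prefix of `q`, and test `W` on it. `W'` is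
defined for all `z`, but only means something where `G` is the graph of a sequence; this
accommodates the outputs of partial machines. -/
theorem Semi.subst_graph {W : Cantor → α → Prop} (hW : Semi W)
    {G : Cantor → α → ℕ → Bool → Prop}
    (hG : Semi fun z (x : α × ℕ × Bool) => G z x.1 x.2.1 x.2.2) :
    ∃ W' : Cantor → α → Prop, Semi W' ∧
      ∀ z a q, (∀ k b, G z a k b ↔ q k = b) → (W' z a ↔ W q a) := by
  obtain ⟨Q, hQ, -, hW⟩ := hW
  refine ⟨fun z a => ∃ l : List Bool, Q l a ∧ ∀ i < l.length, ∃ b, l[i]? = some b ∧ G z a i b,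
    ?_, fun z a q h => ?_⟩
  · refine Semi.exists_ (Semi.and (Semi.of_primrecPred ?_) (Semi.forall_lt
      (W := fun z (x : α × List Bool) i => ∃ b, x.2[i]? = some b ∧ G z x.1 i b)
      (Semi.exists_ (Semi.and (Semi.of_primrecPred ?_) ?_)) (by fun_prop)))
    · exact hQ.comp (f := fun x : α × List Bool => (x.2, x.1)) (by fun_prop)
    · exact primrecPred_eq (by fun_prop) (by fun_prop)
    · exact hG.comp (f := fun x : ((α × List Bool) × ℕ) × Bool => (x.1.1.1, x.1.2, x.2))
        (by fun_prop)
  · simp only [h]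
    rw [hW]
    constructor
    · rintro ⟨l, hl, h'⟩
      refine ⟨l.length, ?_⟩
      convert hl
      apply List.ext_getElem?
      intro i
      rw [getElem?_pre]
      split_ifs with hi
      · obtain ⟨b, hb, rfl⟩ := h' i hi
        exact hb.symm
      · simpa using hi
    · rintro ⟨m, hm⟩
      refine ⟨pre q m, hm, fun i hi => ⟨q i, ?_, rfl⟩⟩
      rw [length_pre] at hi
      rw [getElem?_pre, if_pos hi]

/-- Computability of a map `{0,1}^ℕ × α → {0,1}^ℕ`. -/
def CMap (F : Cantor → α → Cantor) : Prop :=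
  Semi fun z (x : α × ℕ × Bool) => F z x.1 x.2.1 = x.2.2

theorem Semi.subst {W : Cantor → α → Prop} (hW : Semi W) {F : Cantor → α → Cantor} (hF : CMap F) :
    Semi fun z a => W (F z a) a := by
  obtain ⟨W', hW', h⟩ := hW.subst_graph (G := fun z a k b => F z a k = b) hF
  exact hW'.of_eq fun z a => h z a (F z a) fun k b => Iff.rfl

namespace CMap

theorem id : CMap fun z (_ : α) => z := Semi.bit (by fun_prop) (by fun_prop)

theorem reindex {F : Cantor → α → Cantor} (hF : CMap F) {f : β → α} (hf : Primrec f) :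
    CMap fun z b => F z (f b) :=
  Semi.comp hF (f := fun x : β × ℕ × Bool => (f x.1, x.2)) (by fun_prop)

theorem fst {F : Cantor → α → Cantor} (hF : CMap F) : CMap fun z a => (F z a).fst :=
  Semi.comp hF (f := fun x : α × ℕ × Bool => (x.1, 2 * x.2.1, x.2.2)) (by fun_prop)

theorem snd {F : Cantor → α → Cantor} (hF : CMap F) : CMap fun z a => (F z a).snd :=
  Semi.comp hF (f := fun x : α × ℕ × Bool => (x.1, 2 * x.2.1 + 1, x.2.2)) (by fun_prop)

theorem drop {F : Cantor → α → Cantor} (hF : CMap F) {n : α → ℕ} (hn : Primrec n) :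
    CMap fun z a => drop (n a) (F z a) :=
  Semi.comp hF (f := fun x : α × ℕ × Bool => (x.1, n x.1 + x.2.1, x.2.2)) (by fun_prop)

theorem unit {n : α → ℕ} (hn : Primrec n) : CMap fun _ a => unit (n a) := by
  refine Semi.of_primrecPred (P := fun x : α × ℕ × Bool => decide (x.2.1 = n x.1) = x.2.2) ?_
  refine primrecPred_eq ?_ (by fun_prop)
  exact (primrecPred_eq (α := α × ℕ × Bool) (f := fun x => x.2.1) (g := fun x => n x.1)
    (by fun_prop) (by fun_prop)).decide

/-- The value of a symbol of `o` is witnessed by a halting time of a program for `o`, and bounded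
evaluation is primitive recursive. -/
theorem const {o : Cantor} (ho : Computable o) : CMap fun _ (_ : α) => o := by
  obtain ⟨c, hc⟩ := Code.exists_code.1 ho
  have h : Semi fun _ (x : (α × ℕ × Bool) × ℕ) =>
      c.evaln x.2 x.1.2.1 = some (Encodable.encode x.1.2.2) :=
    Semi.of_primrecPred (primrecPred_eq (by fun_prop) (by fun_prop))
  refine (Semi.exists_ (W := fun _ (x : α × ℕ × Bool) t =>
    c.evaln t x.2.1 = some (Encodable.encode x.2.2)) h).of_eq fun p x => ?_
  have := congrFun hc x.2.1
  simp only [Encodable.decode_nat, PFun.coe_val, Part.coe_some, Part.bind_some, Part.map_some]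
    at this
  have h2 : Encodable.encode x.2.2 ∈ c.eval x.2.1 ↔ _ := Code.evaln_complete
  rw [this, Part.mem_some_iff, Encodable.encode_inj] at h2
  exact h2.symm.trans eq_comm

theorem ite {F G : Cantor → α × ℕ → Bool} {P : α × ℕ → Prop} [DecidablePred P]
    (hF : Semi fun z (x : α × ℕ × Bool) => F z (x.1, x.2.1) = x.2.2)
    (hG : Semi fun z (x : α × ℕ × Bool) => G z (x.1, x.2.1) = x.2.2) (hP : PrimrecPred P) :
    CMap fun z a i => if P (a, i) then F z (a, i) else G z (a, i) := by
  have hP' := hP.comp (f := fun x : α × ℕ × Bool => (x.1, x.2.1)) (by fun_prop)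
  refine (((Semi.of_primrecPred hP').and hF).or
    ((Semi.of_primrecPred hP'.not).and hG)).of_eq fun z x => ?_
  by_cases h : P (x.1, x.2.1) <;> simp [h]

theorem pair {F G : Cantor → α → Cantor} (hF : CMap F) (hG : CMap G) :
    CMap fun z a => pair (F z a) (G z a) :=
  ite (F := fun z x => F z x.1 (x.2 / 2)) (G := fun z x => G z x.1 (x.2 / 2))
    (P := fun x => x.2 % 2 = 0)
    (Semi.comp hF (f := fun x : α × ℕ × Bool => (x.1, x.2.1 / 2, x.2.2)) (by fun_prop))
    (Semi.comp hG (f := fun x : α × ℕ × Bool => (x.1, x.2.1 / 2, x.2.2)) (by fun_prop))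
    (primrecPred_eq (by fun_prop) (by fun_prop))

theorem tag {F : Cantor → α → Cantor} (hF : CMap F) (n : ℕ) : CMap fun z a => tag n (F z a) :=
  ite (F := fun _ _ => false) (G := fun z x => if x.2 = n then true else F z x.1 (x.2 - n - 1))
    (P := fun x => x.2 < n)
    (Semi.of_primrecPred (primrecPred_eq (by fun_prop) (by fun_prop)))
    (ite (F := fun _ _ => true) (G := fun z x => F z x.1 (x.2 - n - 1)) (P := fun x => x.2 = n)
      (Semi.of_primrecPred (primrecPred_eq (by fun_prop) (by fun_prop)))
      (Semi.comp hF (f := fun x : α × ℕ × Bool => (x.1, x.2.1 - n - 1, x.2.2)) (by fun_prop))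
      (primrecPred_eq (by fun_prop) (by fun_prop)))
    (primrecPred_lt (by fun_prop) (by fun_prop))

end CMap

/-- Computable total maps are computed by machines. -/
theorem exists_code_of_cmap {F : Cantor → Cantor} (hF : CMap fun z (_ : Unit) => F z) :
    ∃ c : Code, ∀ p, F p ∈ run c p := by
  obtain ⟨c, hc⟩ := exists_code_of_semi (G := fun z x => F z x.1 = x.2)
    (Semi.comp hF (f := fun x : ℕ × Bool => ((), x)) (by fun_prop))
  exact ⟨c, fun p => hc p (F p) (fun _ => rfl) fun _ _ h => h⟩

/-! ### Evaluation of function names -/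

/-- The machine with oracle that is described by `q` outputs the symbol `b` at position `k` on the
input `p`. -/
def EvalBit (q p : Cantor) (k : ℕ) (b : Bool) : Prop :=
  ∃ n o, q = tag n o ∧ b ∈ outputBit (Denumerable.ofNat Code n) (pair o p) k

theorem evalBit_tag {n : ℕ} {o p : Cantor} {k : ℕ} {b : Bool} :
    EvalBit (tag n o) p k b ↔ b ∈ outputBit (Denumerable.ofNat Code n) (pair o p) k := by
  constructor
  · rintro ⟨m, o', h, hb⟩
    obtain ⟨rfl, rfl⟩ := Cantor.tag_inj h
    exact hb
  · exact fun h => ⟨n, o, rfl, h⟩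

/-- The effective form of the decoding: the first `1` in `q` gives the machine number, and what
follows is the oracle. -/
theorem evalBit_iff {q p : Cantor} {k : ℕ} {b : Bool} :
    EvalBit q p k b ↔ ∃ n, q n = true ∧ (∀ i < n, q i = false) ∧
      b ∈ outputBit (Denumerable.ofNat Code n) (pair (drop (n + 1) q) p) k := by
  constructor
  · rintro ⟨n, o, rfl, hb⟩
    exact ⟨n, by simp [tag], fun i hi => by simp [tag, hi], by rwa [Cantor.drop_tag]⟩
  · rintro ⟨n, h, h', hb⟩
    exact ⟨n, _, (Cantor.tag_drop h h').symm, hb⟩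

theorem Semi.evalBit {F G : Cantor → α → Cantor} (hF : CMap F) (hG : CMap G) {k : α → ℕ}
    (hk : Primrec k) {b : α → Bool} (hb : Primrec b) :
    Semi fun z a => EvalBit (F z a) (G z a) (k a) (b a) := by
  simp only [evalBit_iff]
  refine Semi.exists_ (Semi.and ?_ (Semi.and ?_ ?_))
  · exact Semi.comp hF (f := fun x : α × ℕ => (x.1, x.2, true)) (by fun_prop)
  · exact Semi.forall_lt (W := fun z (x : α × ℕ) i => F z x.1 i = false)
      (Semi.comp hF (f := fun x : (α × ℕ) × ℕ => (x.1.1, x.2, false)) (by fun_prop)) (by fun_prop)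
  · have hn : Primrec fun x : α × ℕ => (Denumerable.ofNat Code x.2, k x.1, b x.1) :=
      ((Primrec.ofNat Code).comp Primrec.snd).pair (by fun_prop)
    exact (semi_outputBit.comp hn).subst
      (((hF.reindex (f := fun x : α × ℕ => x.1) (by fun_prop)).drop (by fun_prop)).pair
        (hG.reindex (by fun_prop)))

/-- The machine with oracle that is described by `q` outputs some symbol `1` on the input `p`. -/
def Accepts (q p : Cantor) : Prop := ∃ k, EvalBit q p k true

theorem Semi.accepts {F G : Cantor → α → Cantor} (hF : CMap F) (hG : CMap G) :
    Semi fun z a => Accepts (F z a) (G z a) :=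
  Semi.exists_ (Semi.evalBit (hF.reindex (by fun_prop)) (hG.reindex (by fun_prop)) (by fun_prop)
    (by fun_prop))

theorem exists_runOracle {G : Cantor → ℕ × Bool → Prop} (hG : Semi G) :
    ∃ n, ∀ r p q : Cantor, (∀ k, G (Cantor.pair r p) (k, q k)) →
      (∀ k b, G (Cantor.pair r p) (k, b) → q k = b) → q ∈ runOracle n r p := by
  obtain ⟨c, hc⟩ := exists_code_of_semi hG
  refine ⟨Encodable.encode c, fun r p q => ?_⟩
  rw [runOracle, Denumerable.ofNat_encode]
  exact hc _ _

end TypeTwo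

/-! ### Partial substitution, selection and semidecision -/

namespace TypeTwo

open Nat.Partrec (Code)
open Cantor (pair tag unit)

variable {α β : Type*} [Primcodable α] [Primcodable β]

theorem pair_agree {r p p' : Cantor} {m : ℕ} (h : ∀ i < m, p i = p' i) :
    ∀ i < m, pair r p i = pair r p' i := by
  intro i hi
  simp only [pair]
  rw [h (i / 2) (by omega)]

/-- Substitution of a partial map, given by its graph, for the first component of a pair. -/
theorem Semi.subst_graph_pair {W : Cantor → α → Prop} (hW : Semi W)
    {G : Cantor → α → ℕ → Bool → Prop}
    (hG : Semi fun z (x : α × ℕ × Bool) => G z x.1 x.2.1 x.2.2)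
    {H : Cantor → α → Cantor} (hH : CMap H) :
    ∃ W' : Cantor → α → Prop, Semi W' ∧
      ∀ z a q, (∀ k b, G z a k b ↔ q k = b) → (W' z a ↔ W (pair q (H z a)) a) := by
  have hP : PrimrecPred fun x : α × ℕ × Bool => x.2.1 % 2 = 0 :=
    primrecPred_eq (by fun_prop) (by fun_prop)
  obtain ⟨W', hW', h⟩ := hW.subst_graph
    (G := fun z a k b => (k % 2 = 0 ∧ G z a (k / 2) b) ∨ (¬ k % 2 = 0 ∧ H z a (k / 2) = b))
    (((Semi.of_primrecPred hP).and (hG.comp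
      (f := fun x : α × ℕ × Bool => (x.1, x.2.1 / 2, x.2.2)) (by fun_prop))).or
    ((Semi.of_primrecPred hP.not).and (Semi.comp hH
      (f := fun x : α × ℕ × Bool => (x.1, x.2.1 / 2, x.2.2)) (by fun_prop))))
  refine ⟨W', hW', fun z a q hq => h z a _ fun k b => ?_⟩
  by_cases hk : k % 2 = 0 <;> simp [pair, hk, hq]

/-- A machine that finds a witness for an effectively open predicate. -/
theorem exists_code_select {S : Cantor → ℕ → Prop} (hS : Semi S) :
    ∃ c : Code, ∀ p, (∃ N, S p N) → ∃ N, S p N ∧ unit N ∈ run c p := by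
  classical
  obtain ⟨Q, hQ, -, hS⟩ := hS
  have hD : PrimrecPred fun x : List Bool × ℕ => Q x.1 x.2.unpair.2 :=
    hQ.comp (f := fun x : List Bool × ℕ => (x.1, x.2.unpair.2))
      (by fun_prop)
  have hu : Primrec fun n : ℕ => n.unpair.1 := by fun_prop
  have hpos : Semi fun p (n : ℕ) => Q (pre p n.unpair.1) n.unpair.2 :=
    Semi.of_pre (Q := fun l n => Q l n.unpair.2) hD hu
  have hneg : Semi fun p (n : ℕ) => ¬ Q (pre p n.unpair.1) n.unpair.2 :=
    Semi.of_pre (Q := fun l n => ¬ Q l n.unpair.2) hD.not hu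
  -- Here `n` codes a prefix length together with a candidate `N`. Insisting on the least successful
  -- code makes the output unique although many `N` may qualify; failure of smaller codes is
  -- decidable since each inspects one fixed prefix.
  obtain ⟨c, hc⟩ := exists_code_of_semi (G := fun p (x : ℕ × Bool) => ∃ n : ℕ,
      Q (pre p n.unpair.1) n.unpair.2 ∧ (∀ i < n, ¬ Q (pre p i.unpair.1) i.unpair.2) ∧
        decide (x.1 = n.unpair.2) = x.2) <| by
    refine Semi.exists_ (Semi.and ?_ (Semi.and ?_ (Semi.of_primrecPred ?_)))
    · exact hpos.comp (f := fun x : (ℕ × Bool) × ℕ => x.2) (by fun_prop)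
    · exact Semi.forall_lt (W := fun p (_ : (ℕ × Bool) × ℕ) (i : ℕ) =>
        ¬ Q (pre p i.unpair.1) i.unpair.2)
        (hneg.comp (f := fun x : ((ℕ × Bool) × ℕ) × ℕ => x.2) (by fun_prop)) (by fun_prop)
    · refine primrecPred_eq ?_ (by fun_prop)
      exact (primrecPred_eq (α := (ℕ × Bool) × ℕ) (f := fun x => x.1.1)
        (g := fun x => x.2.unpair.2) (by fun_prop) (by fun_prop)).decide
  refine ⟨c, fun p hp => ?_⟩
  have hex : ∃ n : ℕ, Q (pre p n.unpair.1) n.unpair.2 := by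
    obtain ⟨N, hN⟩ := hp
    obtain ⟨m, hm⟩ := (hS p N).1 hN
    exact ⟨Nat.pair m N, by simpa using hm⟩
  refine ⟨(Nat.find hex).unpair.2, (hS _ _).2 ⟨_, Nat.find_spec hex⟩, hc _ _ (fun k =>
    ⟨Nat.find hex, Nat.find_spec hex, fun i hi => Nat.find_min hex hi, rfl⟩) ?_⟩
  rintro k b ⟨n, hn, hn', hb⟩
  obtain rfl : Nat.find hex = n := (Nat.find_eq_iff hex).2 ⟨hn, fun i hi => hn' i hi⟩
  exact hb

/-- A total machine that semidecides an effectively open predicate. -/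
theorem exists_runOracle_semi {W : Cantor → Prop} (hW : Semi fun z (_ : Unit) => W z) :
    ∃ n, ∀ r p, ∃ q ∈ runOracle n r p, (W (pair r p) ↔ ∃ i, q i = true) := by
  classical
  obtain ⟨Q, hQ, -, hW⟩ := hW
  -- Output symbol `k` reports whether the first `k` input symbols pass the check. The machine is
  -- thus total and produces `0^ℕ`, the name of `⊥`, when `W` fails.
  obtain ⟨n, hn⟩ := exists_runOracle
    (G := fun z (x : ℕ × Bool) => decide (Q (pre z x.1) ()) = x.2) <| by
    refine Semi.of_pre (Q := fun l (x : ℕ × Bool) => decide (Q l ()) = x.2) ?_ (by fun_prop)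
    refine primrecPred_eq ?_ (by fun_prop)
    exact PrimrecPred.decide
      (hQ.comp (f := fun x : List Bool × ℕ × Bool => (x.1, ())) (by fun_prop))
  refine ⟨n, fun r p => ⟨_, hn r p (fun k => decide (Q (pre (pair r p) k) ()))
    (fun _ => rfl) fun _ _ h => h, ?_⟩⟩
  refine (hW _ ()).trans ?_
  simp

theorem exists_runOracle_cmap {F : Cantor → Cantor} (hF : CMap fun z (_ : Unit) => F z) :
    ∃ n, ∀ r p, F (pair r p) ∈ runOracle n r p := by
  obtain ⟨n, hn⟩ := exists_runOracle (G := fun z x => F z x.1 = x.2)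
    (Semi.comp hF (f := fun x : ℕ × Bool => ((), x)) (by fun_prop))
  exact ⟨n, fun r p => hn r p _ (fun _ => rfl) fun _ _ h => h⟩

/-! ### Continuity and computability by oracles -/

theorem ContinuousFun.exists_modulus {F : Cantor →. Cantor} (hF : ContinuousFun F) {p q : Cantor}
    (hq : q ∈ F p) (k : ℕ) :
    ∃ m, ∀ p' q', q' ∈ F p' → pre p' m = pre p m → q' k = q k := by
  obtain ⟨hp, rfl⟩ := hq
  have hopen : IsOpen {x : F.Dom | F.asSubtype x k = (F p).get hp k} :=
    (isOpen_discrete {(F p).get hp k}).preimage ((continuous_apply k).comp hF)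
  obtain ⟨V, hV, hVe⟩ := isOpen_induced_iff.1 hopen
  have hpV : p ∈ V := by
    have : (⟨p, hp⟩ : F.Dom) ∈ Subtype.val ⁻¹' V := by
      rw [hVe]
      rfl
    exact this
  obtain ⟨C, ⟨x, m, rfl⟩, hpC, hCV⟩ :=
    (PiNat.isTopologicalBasis_cylinders fun _ : ℕ => Bool).exists_subset_of_mem_open hpV hV
  refine ⟨m, fun p' q' ⟨hp', hq'⟩ h => ?_⟩
  have hp'V : (⟨p', hp'⟩ : F.Dom) ∈ Subtype.val ⁻¹' V := by
    refine hCV fun i hi => ?_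
    exact (pre_eq_pre_iff.1 h i hi).trans (hpC i hi)
  rw [hVe] at hp'V
  rw [← hq']
  exact hp'V

/-- Each output symbol is produced after finitely many input symbols, hence is locally constant on
the domain. -/
theorem continuousFun_run (c : Code) (o : Cantor) :
    ContinuousFun fun p => run c (pair o p) := by
  refine continuous_pi fun k => continuous_def.2 fun s _ => ?_
  rw [isOpen_iff_mem_nhds]
  rintro ⟨p, hp⟩ hs
  obtain ⟨m, hm⟩ := semi_outputBit.exists_modulus (a := (c, k, (run c (pair o p)).get hp k))
    (mem_run.1 (Part.get_mem hp) k)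
  have hC : PiNat.cylinder p m ∈ nhds p :=
    (PiNat.isOpen_cylinder _ _ _).mem_nhds (PiNat.self_mem_cylinder _ _)
  filter_upwards [continuous_subtype_val.continuousAt.preimage_mem_nhds hC]
  rintro ⟨p', hp'⟩ h
  have h1 := hm (pair o p') (pair_agree fun i hi => (h i hi).symm)
  have h2 := Part.mem_unique h1 (mem_run.1 (Part.get_mem hp') k)
  change (run c (pair o p)).get hp k ∈ s at hs
  change (run c (pair o p')).get hp' k ∈ s
  exact (show _ = _ from h2) ▸ hs

end TypeTwo

namespace RepresentedSpace

open TypeTwo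
open Nat.Partrec (Code)
open Cantor (pair tag unit)

/-- The partial multi-valued function `f` with domain `D` has a realizer that is computed by a
machine with an oracle in `K`. -/
def OracleMulti (K : Set Cantor) {X : RepresentedSpace.{u}} {Y : RepresentedSpace.{v}}
    (D : Set X) (f : X → Set Y) : Prop :=
  ∃ o ∈ K, ∃ c : Code, IsRealizer (fun p => run c (pair o p)) D f

theorem continuousMulti_iff {X : RepresentedSpace.{u}} {Y : RepresentedSpace.{v}} {D : Set X}
    {f : X → Set Y} : ContinuousMulti D f ↔ OracleMulti Set.univ D f := by
  classical
  constructor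
  · rintro ⟨F, hF, hr⟩
    -- `S (l, k, b)` says that the prefix `l` forces symbol `k` of the value of `F` to be `b`. The
    -- oracle is the characteristic sequence of `S`; the machine searches for a prefix of its input
    -- that forces the next symbol, and continuity guarantees one.
    let S : List Bool × ℕ × Bool → Prop := fun x =>
      ∀ p q, q ∈ F p → pre p x.1.length = x.1 → q x.2.1 = x.2.2
    let o : Cantor := fun n => decide (∃ x, Encodable.encode x = n ∧ S x)
    have ho : ∀ x, o (Encodable.encode x) = true ↔ S x := by
      intro x
      simp only [o, decide_eq_true_eq, Encodable.encode_inj, exists_eq_left]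
    obtain ⟨c, hc⟩ := exists_code_of_semi (G := fun z (x : ℕ × Bool) => ∃ m n : ℕ,
        Encodable.encode (pre z.snd m, x) = n ∧ z.fst n = true) <| by
      refine Semi.exists_ (Semi.exists_ (Semi.and ?_ ?_))
      · exact (Semi.of_pre
          (Q := fun l (x : ((ℕ × Bool) × ℕ) × ℕ) => Encodable.encode (l, x.1.1) = x.2)
          (f := fun x => x.1.2) (primrecPred_eq (by fun_prop) (by fun_prop))
          (by fun_prop)).subst CMap.id.snd
      · exact Semi.comp CMap.id.fst (f := fun x : ((ℕ × Bool) × ℕ) × ℕ => ((), x.2, true))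
          (by fun_prop)
    simp only [exists_eq_left'] at hc
    refine ⟨o, trivial, c, fun p x hp hx => ?_⟩
    obtain ⟨q, hq, hy⟩ := hr p x hp hx
    refine ⟨q, hc _ q (fun k => ?_) (fun k b => ?_), hy⟩
    · obtain ⟨m, hm⟩ := hF.exists_modulus hq k
      simp only [Cantor.fst_pair, Cantor.snd_pair, ho, S, length_pre]
      exact ⟨m, hm⟩
    · simp only [Cantor.fst_pair, Cantor.snd_pair, ho, S, length_pre]
      rintro ⟨m, hm⟩
      exact hm p q hq rfl
  · rintro ⟨o, -, c, h⟩
    exact ⟨_, continuousFun_run c o, h⟩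

theorem computableMulti_iff {X : RepresentedSpace.{u}} {Y : RepresentedSpace.{v}} {D : Set X}
    {f : X → Set Y} : ComputableMulti D f ↔ OracleMulti {o | Computable o} D f := by
  constructor
  · rintro ⟨_, ⟨c, rfl⟩, hr⟩
    obtain ⟨c', hc'⟩ := exists_code_of_semi (G := fun z (x : ℕ × Bool) =>
        x.2 ∈ outputBit c z.snd x.1)
      ((semi_outputBit.comp (f := fun x : ℕ × Bool => (c, x)) (by fun_prop)).subst CMap.id.snd)
    refine ⟨fun _ => false, Computable.const false, c', fun p x hp hx => ?_⟩
    obtain ⟨q, hq, hy⟩ := hr p x hp hx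
    refine ⟨q, hc' _ q ?_ ?_, hy⟩ <;> simp only [Cantor.snd_pair, run_singleValued hq]
    · exact fun _ => trivial
    · exact fun _ _ h => h
  · rintro ⟨o, ho, c, hr⟩
    obtain ⟨c', hc'⟩ := exists_code_of_semi (G := fun z (x : ℕ × Bool) =>
        x.2 ∈ outputBit c (pair o z) x.1)
      ((semi_outputBit.comp (f := fun x : ℕ × Bool => (c, x)) (by fun_prop)).subst
        ((CMap.const ho).pair CMap.id))
    refine ⟨_, ⟨c', rfl⟩, fun p x hp hx => ?_⟩
    obtain ⟨q, hq, hy⟩ := hr p x hp hx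
    refine ⟨q, hc' _ q ?_ ?_, hy⟩ <;> simp only [run_singleValued hq]
    · exact fun _ => trivial
    · exact fun _ _ h => h

theorem OracleMulti.transfer {K : Set Cantor} {X : RepresentedSpace.{u}}
    {X' : RepresentedSpace.{w}} {Y : RepresentedSpace.{v}} {D : Set X} {D' : Set X'}
    {f : X → Set Y} {f' : X' → Set Y} (h : OracleMulti K D f)
    (H : ∀ p x', X'.IsName p x' → x' ∈ D' → ∃ x, X.IsName p x ∧ x ∈ D ∧ f x ⊆ f' x') :
    OracleMulti K D' f' := by
  obtain ⟨o, ho, c, hr⟩ := h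
  refine ⟨o, ho, c, fun p x' hp hx' => ?_⟩
  obtain ⟨x, hx, hD, hf⟩ := H p x' hp hx'
  obtain ⟨q, hq, y, hy, hqy⟩ := hr p x hx hD
  exact ⟨q, hq, y, hf hy, hqy⟩

/-- The functions into Sierpiński space that have a realizer are the semidecidable predicates. -/
theorem oracleMulti_sierpinski {K : Set Cantor} {X : RepresentedSpace.{u}} {f : X → sierpinski} :
    OracleMulti K Set.univ (fun x => {f x}) ↔
      ∃ o ∈ K, ∃ W : Cantor → Prop, Semi (fun z (_ : Unit) => W z) ∧
        ∀ p x, X.IsName p x → (W (pair o p) ↔ f x) := by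
  constructor
  · rintro ⟨o, ho, c, hr⟩
    refine ⟨o, ho, fun z => ∃ k, true ∈ outputBit c z k, Semi.exists_ (semi_outputBit.comp
      (f := fun x : Unit × ℕ => (c, x.2, true)) (by fun_prop)), fun p x hp => ?_⟩
    obtain ⟨q, hq, y, rfl, hy⟩ := hr p x hp trivial
    simp only [run_singleValued hq]
    exact Iff.symm hy
  · rintro ⟨o, ho, W, hW, h⟩
    obtain ⟨n, hn⟩ := exists_runOracle_semi hW
    refine ⟨o, ho, Denumerable.ofNat Code n, fun p x hp _ => ?_⟩
    obtain ⟨q, hq, hqW⟩ := hn o p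
    exact ⟨q, hq, f x, rfl, (h p x hp).symm.trans hqW⟩

/-! ### Names of open sets and of sequences of open sets -/

/-- `q` is a name of the open set `U`. -/
abbrev IsOpenName {X : RepresentedSpace.{u}} (q : Cantor) (U : Set X) : Prop :=
  IsFunName (Y := sierpinski) q fun x => x ∈ U

theorem isFunName_iff_compl {X : RepresentedSpace.{u}} {q : Cantor} {U : Set X} :
    IsFunName (Y := sierpinski) q (fun x => x ∉ Uᶜ) ↔ IsOpenName q U := by
  simp only [Set.mem_compl_iff, not_not]

theorem IsOpenName.accepts_iff {X : RepresentedSpace.{u}} {q : Cantor} {U : Set X}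
    (h : IsOpenName q U) {p : Cantor} {x : X} (hp : X.IsName p x) : Accepts q p ↔ x ∈ U := by
  obtain ⟨n, o, rfl, hr⟩ := h
  obtain ⟨r, hr, y, rfl, hy⟩ := hr p x hp trivial
  simp only [Accepts, evalBit_tag, run_singleValued hr]
  exact Iff.symm hy

/-- An s-m-n principle: the machine number depends on `W` alone and all parameters go into the
oracle `r`, so the name `tag n r` is computable from `r`, uniformly in the space and the set. -/
theorem exists_openName {W : Cantor → Prop} (hW : Semi fun z (_ : Unit) => W z) :
    ∃ n, ∀ (X : RepresentedSpace.{u}) (r : Cantor) (U : Set X),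
      (∀ p x, X.IsName p x → (W (pair r p) ↔ x ∈ U)) → IsOpenName (tag n r) U := by
  obtain ⟨n, hn⟩ := exists_runOracle_semi hW
  refine ⟨n, fun X r U h => ⟨n, r, rfl, fun p x hp _ => ?_⟩⟩
  obtain ⟨q, hq, hqW⟩ := hn r p
  exact ⟨q, hq, x ∈ U, rfl, (h p x hp).symm.trans hqW⟩

theorem exists_seqName {W : Cantor → ℕ → Prop} (hW : Semi W) :
    ∃ n, ∀ (X : RepresentedSpace.{u}) (r : Cantor) (U : ℕ → Set X),
      (∀ k p x, X.IsName p x → (W (pair r p) k ↔ x ∈ U k)) →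
      ∃ s : nat.functions X.opens, (nat.functions X.opens).IsName (tag n r) s ∧
        ∀ k : ℕ, (s.1 k).1 = U k := by
  -- The parameter pairs `r` with the name `unit k` of the index, which is recovered as the position
  -- of the symbol `1`. The outer machine only has to output `tag n' (pair r (unit k))`.
  obtain ⟨n', hn'⟩ := exists_openName.{u}
    (W := fun z => ∃ k, z.fst.snd k = true ∧ W (pair z.fst.fst z.snd) k) <| by
    refine Semi.exists_ (Semi.and ?_ ?_)
    · exact Semi.comp CMap.id.fst.snd (f := fun x : Unit × ℕ => ((), x.2, true)) (by fun_prop)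
    · exact (hW.comp (f := fun x : Unit × ℕ => x.2) (by fun_prop)).subst
        (CMap.id.fst.fst.pair CMap.id.snd)
  obtain ⟨n, hn⟩ := exists_runOracle_cmap (F := fun z => tag n' z) (CMap.id.tag n')
  refine ⟨n, fun X r U h => ?_⟩
  have hU : ∀ k, IsOpenName (tag n' (pair r (unit k))) (U k) := by
    intro k
    refine hn' X _ _ fun p x hp => ?_
    simp [unit, h k p x hp]
  have hs : IsFunName (X := nat) (Y := X.opens) (tag n r) fun k => ⟨U k, _, hU k⟩ := by
    refine ⟨n, r, rfl, ?_⟩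
    rintro _ k rfl -
    exact ⟨_, hn r (unit k), _, rfl, hU k⟩
  exact ⟨⟨_, _, hs⟩, hs, fun _ => rfl⟩

/-- Evaluation of sequences: run the machine named by `q` on `unit k`, and feed `p` to the machine
named by the result. The intermediate result comes from a partial machine, hence the substitution
through its graph. -/
theorem exists_seqAccepts : ∃ A : Cantor → ℕ → Prop, Semi A ∧
    ∀ (X : RepresentedSpace.{u}) (q : Cantor) (s : nat.functions X.opens),
      (nat.functions X.opens).IsName q s → ∀ p x, X.IsName p x → ∀ k : ℕ,
        (A (pair q p) k ↔ x ∈ (s.1 k).1) := by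
  obtain ⟨A, hA, h⟩ := (Semi.accepts (α := ℕ) CMap.id.fst CMap.id.snd).subst_graph_pair
    (G := fun z k i b => EvalBit z.fst (unit k) i b)
    (Semi.evalBit CMap.id.fst (CMap.unit (by fun_prop)) (by fun_prop) (by fun_prop))
    CMap.id.snd
  refine ⟨A, hA, fun X q s hs p x hp k => ?_⟩
  obtain ⟨n, o, rfl, hr⟩ := hs
  obtain ⟨r, hr, y, rfl, hy⟩ := hr (unit k) k rfl trivial
  rw [h _ k r]
  · rw [Cantor.fst_pair, Cantor.snd_pair, Cantor.snd_pair]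
    exact IsOpenName.accepts_iff hy hp
  · intro i b
    rw [Cantor.fst_pair, evalBit_tag, run_singleValued hr]

end RepresentedSpace

/-! ### Compactness as semidecidability of fullness -/

namespace RepresentedSpace

open TypeTwo
open Nat.Partrec (Code)
open Cantor (pair tag unit)

/-- With the help of an oracle in `K`, the name of `X` can be recognized among the names of its open
sets. -/
def FullSemi (K : Set Cantor) (X : RepresentedSpace.{u}) : Prop :=
  ∃ o ∈ K, ∃ W : Cantor → Prop, Semi (fun z (_ : Unit) => W z) ∧
    ∀ (q : Cantor) (U : Set X), IsOpenName q U → (W (pair o q) ↔ U = Set.univ)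

variable {K : Set Cantor} {X : RepresentedSpace.{u}}

theorem oracleMulti_isFull_iff :
    OracleMulti K Set.univ (fun U => {X.isFull U}) ↔ FullSemi K X := by
  rw [oracleMulti_sierpinski]
  constructor
  · rintro ⟨o, ho, W, hW, h⟩
    exact ⟨o, ho, W, hW, fun q U hq => h q ⟨U, q, hq⟩ hq⟩
  · rintro ⟨o, ho, W, hW, h⟩
    exact ⟨o, ho, W, hW, fun q U hq => h q U.1 hq⟩

/-- A closed set and its open complement have literally the same names. -/
theorem oracleMulti_isEmpty_iff :
    OracleMulti K Set.univ (fun A => {X.isEmpty A}) ↔ FullSemi K X := by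
  rw [oracleMulti_sierpinski]
  constructor
  · rintro ⟨o, ho, W, hW, h⟩
    refine ⟨o, ho, W, hW, fun q U hq => ?_⟩
    have hq' := isFunName_iff_compl.2 hq
    exact (h q ⟨Uᶜ, q, hq'⟩ hq').trans Set.compl_empty_iff
  · rintro ⟨o, ho, W, hW, h⟩
    exact ⟨o, ho, W, hW, fun q A hq => (h q A.1ᶜ hq).trans Set.compl_univ_iff⟩

/-- The union of two open sets can be computed. -/
theorem exists_unionName : ∃ n, ∀ (X : RepresentedSpace.{u}) (r : Cantor) (U : Set X),
    (∀ p x, X.IsName p x → (Accepts r.fst p ∨ Accepts r.snd p ↔ x ∈ U)) →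
      IsOpenName (tag n r) U := by
  obtain ⟨n, hn⟩ := exists_openName.{u}
    (W := fun z => Accepts z.fst.fst z.snd ∨ Accepts z.fst.snd z.snd)
    ((Semi.accepts CMap.id.fst.fst CMap.id.snd).or (Semi.accepts CMap.id.fst.snd CMap.id.snd))
  exact ⟨n, fun X r U h => hn X r U (by simpa using h)⟩

theorem exists_emptyName : ∃ n, ∀ (X : RepresentedSpace.{u}) (r : Cantor),
    IsOpenName (tag n r) (∅ : Set X) := by
  obtain ⟨n, hn⟩ := exists_openName.{u} (W := fun _ => False)
    (Semi.of_primrecPred (primrecPred_lt (f := fun _ => 0) (g := fun _ => 0)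
      (by fun_prop) (by fun_prop))|>.of_eq fun _ _ => by simp)
  exact ⟨n, fun X r => hn X r ∅ (by simp)⟩

/-- `A ⊆ U` iff `Aᶜ ∪ U = X`, and the union can be named from names of `A` and `U`. Conversely,
fullness of `U` is the inclusion of the closed set `X` in `U`. -/
theorem oracleMulti_subsetMap_iff :
    OracleMulti K Set.univ (fun z => {X.subsetMap z}) ↔ FullSemi K X := by
  rw [oracleMulti_sierpinski]
  constructor
  · rintro ⟨o, ho, W, hW, h⟩
    obtain ⟨n, hn⟩ := exists_emptyName.{u}
    -- A name of `∅` as an open set, hence of `X` as a closed set, works with any oracle, so `z.snd`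
    -- fills that place.
    refine ⟨o, ho, fun z => W (pair z.fst (pair (tag n z.snd) z.snd)),
      hW.subst (CMap.id.fst.pair ((CMap.id.snd.tag n).pair CMap.id.snd)), fun q U hq => ?_⟩
    have hA : IsFunName (Y := sierpinski) (tag n q) fun x => x ∉ (Set.univ : Set X) := by
      simpa [IsOpenName] using hn X q
    simp only [Cantor.fst_pair, Cantor.snd_pair]
    refine (h (pair (tag n q) q) (⟨Set.univ, _, hA⟩, ⟨U, q, hq⟩) ⟨?_, ?_⟩).trans Set.univ_subset_iff
    · rw [Cantor.fst_pair]
      exact hA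
    · rw [Cantor.snd_pair]
      exact hq
  · rintro ⟨o, ho, W, hW, h⟩
    obtain ⟨n, hn⟩ := exists_unionName.{u}
    refine ⟨o, ho, fun z => W (pair z.fst (tag n z.snd)),
      hW.subst (CMap.id.fst.pair (CMap.id.snd.tag n)), ?_⟩
    rintro p ⟨A, U⟩ ⟨hA, hU⟩
    simp only [Cantor.fst_pair, Cantor.snd_pair]
    refine (h _ (A.1ᶜ ∪ U.1) ?_).trans ?_
    rotate_left
    · rw [← Set.compl_subset_iff_union, compl_compl]
      rfl
    · refine hn X p _ fun q x hq => ?_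
      rw [IsOpenName.accepts_iff (U := A.1ᶜ) hA hq, IsOpenName.accepts_iff hU hq]
      rfl

theorem oracleMulti_isCover_iff :
    OracleMulti K Set.univ (fun U => {X.isCover U}) ↔ FullSemi K X := by
  rw [oracleMulti_sierpinski]
  constructor
  · rintro ⟨o, ho, W, hW, h⟩
    obtain ⟨n, hn⟩ := exists_seqName.{u} (W := fun z _ => Accepts z.fst z.snd)
      (Semi.accepts CMap.id.fst CMap.id.snd)
    refine ⟨o, ho, fun z => W (pair z.fst (tag n z.snd)),
      hW.subst (CMap.id.fst.pair (CMap.id.snd.tag n)), fun q U hq => ?_⟩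
    obtain ⟨s, hs, hsU⟩ := hn X q (fun _ => U) fun k p x hp => by
      simpa using hq.accepts_iff hp
    simp only [Cantor.fst_pair, Cantor.snd_pair]
    refine (h _ s hs).trans ?_
    simp only [isCover, hsU, Set.iUnion_const]
  · rintro ⟨o, ho, W, hW, h⟩
    obtain ⟨A, hA, hAs⟩ := exists_seqAccepts.{u}
    obtain ⟨n, hn⟩ := exists_openName.{u} (W := fun z => ∃ k, A z k)
      (Semi.exists_ (hA.comp (f := fun x : Unit × ℕ => x.2) (by fun_prop)))
    refine ⟨o, ho, fun z => W (pair z.fst (tag n z.snd)),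
      hW.subst (CMap.id.fst.pair (CMap.id.snd.tag n)), fun q s hs => ?_⟩
    simp only [Cantor.fst_pair, Cantor.snd_pair]
    refine (h _ (⋃ k : ℕ, (s.1 k).1) (hn X q _ fun p x hp => ?_)).trans Iff.rfl
    simp only [hAs X q s hs p x hp, Set.mem_iUnion]

theorem FullSemi.finiteSubcover (hX : FullSemi K X) :
    OracleMulti K X.finiteSubcoverDom X.finiteSubcover := by
  obtain ⟨o, ho, W, hW, h⟩ := hX
  obtain ⟨A, hA, hAs⟩ := exists_seqAccepts.{u}
  -- A control sequence `t` admits `U_k` as long as `t` shows no `1` up to index `k`. Thus `t = 0^ℕ`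
  -- yields the whole union and `t = unit (N + 1)` yields `U_0 ∪ … ∪ U_N`.
  obtain ⟨n, hn⟩ := exists_openName.{u} (W := fun z => ∃ k, (∀ i < k + 1, z.fst.snd i = false) ∧
      A (pair z.fst.fst z.snd) k) <| by
    refine Semi.exists_ (Semi.and (Semi.forall_lt
      (W := fun z (x : Unit × ℕ) i => z.fst.snd i = false) ?_ (by fun_prop)) ?_)
    · exact Semi.comp CMap.id.fst.snd (f := fun x : (Unit × ℕ) × ℕ => ((), x.2, false))
        (by fun_prop)
    · exact (hA.comp (f := fun x : Unit × ℕ => x.2) (by fun_prop)).subst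
        (CMap.id.fst.fst.pair CMap.id.snd)
  have hV : Semi fun z (_ : Unit) => W (pair z.fst.fst (tag n (pair z.fst.snd z.snd))) :=
    hW.subst (CMap.id.fst.fst.pair ((CMap.id.fst.snd.pair CMap.id.snd).tag n))
  obtain ⟨c, hc⟩ := exists_code_select
    (S := fun z N => W (pair z.fst (tag n (pair z.snd (unit (N + 1)))))) <|
    (hW.comp (f := fun _ : ℕ => ()) (by fun_prop)).subst
      (CMap.id.fst.pair ((CMap.id.snd.pair (CMap.unit (by fun_prop))).tag n))
  refine ⟨o, ho, c, fun q s hs hcover => ?_⟩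
  have hname : ∀ t : Cantor, IsOpenName (tag n (pair q t))
      {x | ∃ k : ℕ, (∀ i < k + 1, t i = false) ∧ x ∈ (s.1 k).1} := by
    intro t
    refine hn X _ _ fun p x hp => ?_
    simp only [Cantor.fst_pair, Cantor.snd_pair, hAs X q s hs p x hp, Set.mem_ofPred_eq]
  have h0 : W (pair o (tag n (pair q fun _ => false))) := by
    rw [h _ _ (hname _)]
    simpa [finiteSubcoverDom, Set.iUnion_eq_univ_iff, Set.eq_univ_iff_forall] using hcover
  obtain ⟨m, hm⟩ := hV.exists_modulus (p := pair (pair o q) fun _ => false) (a := ())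
    (by simpa using h0)
  -- The acceptance for `0^ℕ` depends on at most `m` symbols, where `unit (m + 1)` is still zero. So
  -- some `N` passes the test and the search succeeds.
  obtain ⟨N, hN, hNr⟩ := hc (pair o q) ⟨m, by
    simpa using hm (pair (pair o q) (unit (m + 1)))
      (pair_agree fun i hi => by simp [unit]; omega)⟩
  refine ⟨_, hNr, N, ?_, rfl⟩
  rw [Cantor.fst_pair, Cantor.snd_pair, h _ _ (hname _), Set.eq_univ_iff_forall] at hN
  refine Set.eq_univ_iff_forall.2 fun x => ?_
  obtain ⟨k, hk, hx⟩ := hN x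
  have hkN : k ≤ N := by
    by_contra hlt
    simpa [unit] using hk (N + 1) (by omega)
  simp only [Set.mem_iUnion]
  exact ⟨k, hkN, hx⟩

theorem FullSemi.of_finiteSubcover (hF : OracleMulti K X.finiteSubcoverDom X.finiteSubcover) :
    FullSemi K X := by
  obtain ⟨o, ho, c, hr⟩ := hF
  -- The control sequence now switches the members from `U` to `X`, starting at the index of its
  -- first `1`.
  obtain ⟨n, hn⟩ := exists_seqName.{u} (W := fun z k => Accepts z.fst.fst z.snd ∨
      ∃ i, i < k + 1 ∧ z.fst.snd i = true) <| by
    refine (Semi.accepts CMap.id.fst.fst CMap.id.snd).or (Semi.exists_ (Semi.and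
      (Semi.of_primrecPred (primrecPred_lt (by fun_prop) (by fun_prop))) ?_))
    exact Semi.comp CMap.id.fst.snd (f := fun x : ℕ × ℕ => (x.1, x.2, true)) (by fun_prop)
  have hV : Semi fun z (N : ℕ) =>
      true ∈ outputBit c (pair z.fst.fst (tag n (pair z.fst.snd z.snd))) N :=
    (semi_outputBit.comp (f := fun N : ℕ => (c, N, true)) (by fun_prop)).subst
      (CMap.id.fst.fst.pair ((CMap.id.fst.snd.pair CMap.id.snd).tag n))
  refine ⟨o, ho, fun z => ∃ N,
    true ∈ outputBit c (pair z.fst (tag n (pair z.snd fun _ => false))) N, ?_, fun q U hq => ?_⟩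
  · refine Semi.exists_ ?_
    exact (semi_outputBit.comp (f := fun x : Unit × ℕ => (c, x.2, true)) (by fun_prop)).subst
      (CMap.id.fst.pair ((CMap.id.snd.pair (CMap.const (Computable.const false))).tag n))
  · simp only [Cantor.fst_pair, Cantor.snd_pair]
    have hname : ∀ t : Cantor, ∃ s : nat.functions X.opens,
        (nat.functions X.opens).IsName (tag n (pair q t)) s ∧
          ∀ k : ℕ, (s.1 k).1 = {x | x ∈ U ∨ ∃ i, i < k + 1 ∧ t i = true} := by
      intro t
      refine hn X _ _ fun k p x hp => ?_
      simp only [Cantor.fst_pair, Cantor.snd_pair, hq.accepts_iff hp, Set.mem_ofPred_eq]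
    constructor
    · rintro ⟨N, hN⟩
      obtain ⟨m, hm⟩ := hV.exists_modulus (p := pair (pair o q) fun _ => false) (a := N)
        (by simpa using hN)
      -- The switch comes after the `m` symbols on which the answer depends, and after index `N`, so
      -- that members `0, …, N` are still `U`. On the original sequence nothing is known about the
      -- machine beyond this single symbol `1`, because that sequence need not cover; the modified
      -- one does.
      have hm' := hm (pair (pair o q) (unit (m + N + 1)))
        (pair_agree fun i hi => by simp [unit]; omega)
      simp only [Cantor.fst_pair, Cantor.snd_pair] at hm'
      obtain ⟨s, hs, hsU⟩ := hname (unit (m + N + 1))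
      obtain ⟨r, hr, M, hM, rfl⟩ := hr _ s hs <| by
        refine Set.eq_univ_iff_forall.2 fun x => Set.mem_iUnion.2 ⟨m + N + 1, ?_⟩
        rw [hsU]
        exact Or.inr ⟨m + N + 1, by omega, by simp [unit]⟩
      have hNM : N = M := by simpa [unit] using (run_singleValued hr _ _).1 hm'
      subst hNM
      refine Set.eq_univ_iff_forall.2 fun x => ?_
      have hx := Set.eq_univ_iff_forall.1 hM x
      simp only [Set.mem_iUnion, hsU, Set.mem_ofPred_eq] at hx
      obtain ⟨k, hk, hx | ⟨i, hi, hti⟩⟩ := hx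
      · exact hx
      · have : i = m + N + 1 := by simpa [unit] using hti
        omega
    · rintro rfl
      obtain ⟨s, hs, hsU⟩ := hname fun _ => false
      obtain ⟨r, hr, N, -, rfl⟩ := hr _ s hs <| by
        refine Set.eq_univ_iff_forall.2 fun x => Set.mem_iUnion.2 ⟨0, ?_⟩
        rw [hsU]
        exact Or.inl trivial
      exact ⟨N, (run_singleValued hr N true).2 (Cantor.unit_self N)⟩

theorem oracleMulti_finiteSubcover_iff :
    OracleMulti K X.finiteSubcoverDom X.finiteSubcover ↔ FullSemi K X :=
  ⟨FullSemi.of_finiteSubcover, FullSemi.finiteSubcover⟩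

/-- De Morgan: taking complements memberwise leaves the names of a sequence unchanged. -/
theorem oracleMulti_enough_iff :
    OracleMulti K X.enoughDom X.enough ↔ FullSemi K X := by
  rw [← oracleMulti_finiteSubcover_iff]
  constructor
  · refine fun h => h.transfer fun q s hs hD => ?_
    have hs' : IsFunName (X := nat) (Y := X.closeds) q fun k =>
        ⟨(s.1 k).1ᶜ, (s.1 k).2.imp fun _ => isFunName_iff_compl.2⟩ := by
      obtain ⟨n, o, rfl, hr⟩ := hs
      refine ⟨n, o, rfl, fun p k hp _ => ?_⟩
      obtain ⟨q, hq, _, rfl, hy⟩ := hr p k hp trivial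
      exact ⟨q, hq, _, rfl, isFunName_iff_compl.2 hy⟩
    refine ⟨⟨_, q, hs'⟩, hs', ?_, fun N hN => ?_⟩
    · change (⋂ n : ℕ, (s.1 n).1ᶜ) = ∅
      rw [← Set.compl_iUnion, Set.compl_empty_iff]
      exact hD
    · change (⋂ n : ℕ, ⋂ _ : n ≤ N, (s.1 n).1ᶜ) = ∅ at hN
      simp only [← Set.compl_iUnion, Set.compl_empty_iff] at hN
      exact hN
  · refine fun h => h.transfer fun q s hs hD => ?_
    have hs' : IsFunName (X := nat) (Y := X.opens) q fun k => ⟨(s.1 k).1ᶜ, (s.1 k).2⟩ := by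
      obtain ⟨n, o, rfl, hr⟩ := hs
      refine ⟨n, o, rfl, fun p k hp _ => ?_⟩
      obtain ⟨q, hq, _, rfl, hy⟩ := hr p k hp trivial
      exact ⟨q, hq, _, rfl, hy⟩
    refine ⟨⟨_, q, hs'⟩, hs', ?_, fun N hN => ?_⟩
    · change (⋃ n : ℕ, (s.1 n).1ᶜ) = Set.univ
      rw [← Set.compl_iInter, Set.compl_univ_iff]
      exact hD
    · change (⋃ n : ℕ, ⋃ _ : n ≤ N, (s.1 n).1ᶜ) = Set.univ at hN
      simp only [← Set.compl_iInter, Set.compl_univ_iff] at hN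
      exact hN

/-! ### Closed subspaces -/

theorem FullSemi.subspace (hX : FullSemi K X) (hK : ∀ o ∈ K, ∀ o' ∈ K, pair o o' ∈ K)
    {A : X.closeds} {a : Cantor} (ha : a ∈ K) (hA : X.closeds.IsName a A) :
    FullSemi K (X.subspace A.1) := by
  obtain ⟨o, ho, W, hW, h⟩ := hX
  obtain ⟨n, hn⟩ := exists_unionName.{u}
  refine ⟨pair o a, hK o ho a ha, fun z => W (pair z.fst.fst (tag n (pair z.fst.snd z.snd))),
    hW.subst (CMap.id.fst.fst.pair ((CMap.id.fst.snd.pair CMap.id.snd).tag n)), fun q U hq => ?_⟩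
  simp only [Cantor.fst_pair, Cantor.snd_pair]
  -- This set is `Aᶜ ∪ U`. The machine for `U` may behave arbitrarily on names of points outside
  -- `A`, but these belong to the set anyway.
  rw [h _ {x | ∀ hx : x ∈ A.1, (⟨x, hx⟩ : A.1) ∈ U}]
  · simp only [Set.eq_univ_iff_forall, Set.mem_ofPred_eq]
    exact ⟨fun H x => H x.1 x.2, fun H x hx => H ⟨x, hx⟩⟩
  · refine hn X _ _ fun p x hp => ?_
    rw [Cantor.fst_pair, Cantor.snd_pair, IsOpenName.accepts_iff (U := A.1ᶜ) hA hp]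
    by_cases hx : x ∈ A.1
    · rw [hq.accepts_iff (x := (⟨x, hx⟩ : A.1)) hp]
      exact ⟨fun h _ => h.resolve_left fun h' => h' hx, fun h => Or.inr (h hx)⟩
    · simp [hx]

theorem FullSemi.of_subspace_univ (h : FullSemi K (X.subspace Set.univ)) : FullSemi K X := by
  obtain ⟨o, ho, W, hW, h⟩ := h
  refine ⟨o, ho, W, hW, fun q U hq => ?_⟩
  have hq' : IsOpenName (X := X.subspace Set.univ) q (Subtype.val ⁻¹' U) := by
    obtain ⟨n, o, rfl, hr⟩ := hq
    exact ⟨n, o, rfl, fun p x hp _ => hr p x.1 hp trivial⟩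
  refine (h q _ hq').trans ?_
  simp only [Set.eq_univ_iff_forall]
  exact ⟨fun H x => H ⟨x, trivial⟩, fun H x => H x.1⟩

theorem computable_unit (n : ℕ) : Computable (unit n) :=
  Primrec.to_comp (Primrec.eq.comp Primrec.id (Primrec.const n)).decide

theorem tag_const_false (n : ℕ) : tag n (fun _ => false) = unit n := by
  funext i
  simp only [tag, unit]
  split_ifs with h1 h2
  · simp; omega
  · simp [h2]
  · simp [h2]

theorem forall_subspace_iff (h0 : ∀ o, Computable o → o ∈ K)
    (hK : ∀ o ∈ K, ∀ o' ∈ K, pair o o' ∈ K) :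
    (∀ A : X.closeds, (∃ a ∈ K, X.closeds.IsName a A) →
      OracleMulti K Set.univ (fun B => {(X.subspace A.1).isEmpty B})) ↔ FullSemi K X := by
  simp only [oracleMulti_isEmpty_iff]
  constructor
  · intro h
    obtain ⟨n, hn⟩ := exists_emptyName.{u}
    -- Choosing the zero oracle makes this name of the closed set `X` computable, so the hypothesis
    -- on subspaces applies to `X` itself.
    have hA : IsFunName (Y := sierpinski) (unit n) fun x => x ∉ (Set.univ : Set X) := by
      simpa [IsOpenName, tag_const_false] using hn X fun _ => false
    exact (h ⟨Set.univ, _, hA⟩ ⟨_, h0 _ (computable_unit n), hA⟩).of_subspace_univ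
  · rintro h A ⟨a, ha, hA⟩
    exact h.subspace hK ha hA

/-! ### Projections -/

theorem FullSemi.projection (hX : FullSemi K X) (Y : RepresentedSpace.{v}) :
    OracleMulti K Set.univ (X.projection Y) := by
  obtain ⟨o, ho, W, hW, h⟩ := hX
  obtain ⟨n, hn⟩ := exists_openName.{u} (W := fun z => Accepts z.fst.fst (pair z.snd z.fst.snd))
    (Semi.accepts CMap.id.fst.fst (CMap.id.snd.pair CMap.id.fst.snd))
  obtain ⟨n', hn'⟩ := exists_openName.{v}
    (W := fun z => W (pair z.fst.fst (tag n (pair z.fst.snd z.snd))))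
    (hW.subst (CMap.id.fst.fst.pair ((CMap.id.fst.snd.pair CMap.id.snd).tag n)))
  obtain ⟨c, hc⟩ := exists_code_of_cmap (F := fun z => tag n' z) (CMap.id.tag n')
  refine ⟨o, ho, c, fun a A ha _ => ⟨_, hc (pair o a), ?_⟩⟩
  have hB : IsFunName (Y := sierpinski) (tag n' (pair o a))
      fun y => y ∉ {y : Y | ∃ x : X, ((x, y) : X × Y) ∈ A.1} := by
    refine hn' Y _ {y : Y | ∃ x : X, ((x, y) : X × Y) ∈ A.1}ᶜ fun r y hr => ?_
    simp only [Cantor.fst_pair, Cantor.snd_pair]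
    -- The slice of the complement of `A` at `y`, named from names of `A` and `y`; it is full iff
    -- `y` is outside the projection.
    rw [h _ {x : X | ((x, y) : X × Y) ∉ A.1}]
    · simp [Set.eq_univ_iff_forall]
    · refine hn X _ _ fun p x hp => ?_
      simp only [Cantor.fst_pair, Cantor.snd_pair]
      refine IsOpenName.accepts_iff (X := X.prod Y) (U := A.1ᶜ) ha (x := (x, y)) ⟨?_, ?_⟩
      · rwa [Cantor.fst_pair]
      · rwa [Cantor.snd_pair]
  exact ⟨⟨_, _, hB⟩, rfl, hB⟩

theorem FullSemi.of_projection (hK : ∀ o ∈ K, ∀ o' ∈ K, pair o o' ∈ K)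
    {Y : RepresentedSpace.{v}} {y : Y} {r : Cantor} (hrK : r ∈ K) (hr : Y.IsName r y)
    (hY : OracleMulti K Set.univ (X.projection Y)) : FullSemi K X := by
  obtain ⟨o, ho, c, hc⟩ := hY
  obtain ⟨n, hn⟩ := exists_openName.{max u v} (W := fun z => Accepts z.fst z.snd.fst)
    (Semi.accepts CMap.id.fst CMap.id.snd.fst)
  -- From a name of `U`, form a name of `Uᶜ × Y`, let `c` compute a name of its projection, and ask
  -- whether that name accepts the name `r` of the fixed point, which is kept in the oracle.
  obtain ⟨W, hW, h⟩ := (Semi.accepts (α := Unit) CMap.id.fst CMap.id.snd).subst_graph_pair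
    (G := fun z _ k b => b ∈ outputBit c (pair z.fst.fst (tag n z.snd)) k)
    ((semi_outputBit.comp (f := fun x : Unit × ℕ × Bool => (c, x.2)) (by fun_prop)).subst
      (CMap.id.fst.fst.pair (CMap.id.snd.tag n)))
    CMap.id.fst.snd
  refine ⟨pair o r, hK o ho r hrK, fun z => W z (), hW, fun q U hq => ?_⟩
  have hA : IsFunName (X := X.prod Y) (Y := sierpinski) (tag n q)
      fun z => z ∉ {z : X × Y | z.1 ∈ U}ᶜ := by
    refine isFunName_iff_compl.2 (hn (X.prod Y) q _ fun p z hp => ?_)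
    rw [Cantor.fst_pair, Cantor.snd_pair]
    exact hq.accepts_iff hp.1
  obtain ⟨b, hb, B, hB, hbB⟩ := hc (tag n q) ⟨_, _, hA⟩ hA trivial
  refine (h _ () b ?_).trans ?_
  rotate_left
  · simp only [Cantor.fst_pair, Cantor.snd_pair]
    rw [IsOpenName.accepts_iff (U := B.1ᶜ) hbB hr]
    change B.1 = {y : Y | ∃ x : X, ((x, y) : X × Y) ∈ {z : X × Y | z.1 ∈ U}ᶜ} at hB
    rw [hB]
    simp [Set.eq_univ_iff_forall]
  · intro k b'
    simp only [Cantor.fst_pair, Cantor.snd_pair, run_singleValued hb]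

/-- The space with one point, which is named by all sequences. -/
def point : RepresentedSpace.{u} where
  carrier := PUnit
  IsName _ _ := True
  unique _ _ := rfl
  surjective _ := ⟨fun _ => false, trivial⟩

/-- Pairing joins the oracle of a realizer with a name of a closed set or of a point of `Y`;
computable sequences supply the fixed names of `X` and of the point of `point`. -/
theorem tfae_compact (h0 : ∀ o, Computable o → o ∈ K) (hK : ∀ o ∈ K, ∀ o' ∈ K, pair o o' ∈ K) :
    List.TFAE
      [ OracleMulti K Set.univ (fun A => {X.isEmpty A}),
        OracleMulti K Set.univ (fun U => {X.isFull U}),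
        ∀ A : X.closeds, (∃ a ∈ K, X.closeds.IsName a A) →
          OracleMulti K Set.univ (fun B => {(X.subspace A.1).isEmpty B}),
        OracleMulti K Set.univ (fun z => {X.subsetMap z}),
        OracleMulti K Set.univ (fun U => {X.isCover U}),
        OracleMulti K X.finiteSubcoverDom X.finiteSubcover,
        OracleMulti K X.enoughDom X.enough,
        ∀ Y : RepresentedSpace.{v}, OracleMulti K Set.univ (X.projection Y),
        ∃ Y : RepresentedSpace.{w}, (∃ y : Y, ∃ r ∈ K, Y.IsName r y) ∧
          OracleMulti K Set.univ (X.projection Y) ] := by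
  have hf := h0 _ (Computable.const false)
  refine List.tfae_of_forall (FullSemi K X) _ ?_
  simp only [List.forall_mem_cons, oracleMulti_isEmpty_iff, oracleMulti_isFull_iff,
    oracleMulti_subsetMap_iff, oracleMulti_isCover_iff, oracleMulti_finiteSubcover_iff,
    oracleMulti_enough_iff, true_and, iff_self]
  refine ⟨?_, ?_, ?_, by simp⟩
  · simpa only [oracleMulti_isEmpty_iff] using forall_subspace_iff h0 hK
  -- The one-point space lives in every universe, so the universes of the two properties of
  -- projections need not be related.
  · exact ⟨fun h => .of_projection (Y := point) (y := PUnit.unit) hK hf trivial (h point),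
      fun h Y => h.projection Y⟩
  · constructor
    · rintro ⟨Y, ⟨y, r, hr, hry⟩, h⟩
      exact .of_projection hK hr hry h
    · exact fun h => ⟨point, ⟨PUnit.unit, _, hf, trivial⟩, h.projection point⟩

end RepresentedSpace

theorem Cantor.computable_pair {p q : Cantor} (hp : Computable p) (hq : Computable q) :
    Computable (pair p q) := by
  have hd : Primrec fun i : ℕ => i / 2 := by fun_prop
  have hm : Primrec fun i : ℕ => decide (i % 2 = 0) :=
    PrimrecPred.decide (TypeTwo.primrecPred_eq (f := fun i : ℕ => i % 2) (by fun_prop)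
      (by fun_prop))
  refine (Computable.cond hm.to_comp (hp.comp hd.to_comp) (hq.comp hd.to_comp)).of_eq fun i => ?_
  by_cases h : i % 2 = 0 <;> simp [pair, h]

theorem proposition8 (X : RepresentedSpace.{u}) :
    List.TFAE
      [ X.IsCompactSpace,
        RepresentedSpace.ContinuousMap X.isFull,
        ∀ A : X.closeds, (X.subspace A.1).IsCompactSpace,
        RepresentedSpace.ContinuousMap X.subsetMap,
        RepresentedSpace.ContinuousMap X.isCover,
        RepresentedSpace.ContinuousMulti X.finiteSubcoverDom X.finiteSubcover,
        RepresentedSpace.ContinuousMulti X.enoughDom X.enough,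
        ∀ Y : RepresentedSpace.{v},
          RepresentedSpace.ContinuousMulti Set.univ (X.projection Y),
        ∃ Y : RepresentedSpace.{w}, Nonempty Y ∧
          RepresentedSpace.ContinuousMulti Set.univ (X.projection Y) ] ∧
    List.TFAE
      [ X.IsComputablyCompactSpace,
        RepresentedSpace.ComputableMap X.isFull,
        ∀ A : X.closeds, RepresentedSpace.ComputablePoint A →
          (X.subspace A.1).IsComputablyCompactSpace,
        RepresentedSpace.ComputableMap X.subsetMap,
        RepresentedSpace.ComputableMap X.isCover,
        RepresentedSpace.ComputableMulti X.finiteSubcoverDom X.finiteSubcover,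
        RepresentedSpace.ComputableMulti X.enoughDom X.enough,
        ∀ Y : RepresentedSpace.{v},
          RepresentedSpace.ComputableMulti Set.univ (X.projection Y),
        ∃ Y : RepresentedSpace.{w}, (∃ y : Y, RepresentedSpace.ComputablePoint y) ∧
          RepresentedSpace.ComputableMulti Set.univ (X.projection Y) ] := by
  constructor
  · have h := RepresentedSpace.tfae_compact.{u, v, w} (K := Set.univ) (X := X)
      (fun _ _ => trivial) fun _ _ _ _ => trivial
    -- With all sequences as oracles, the conditions on names of `A` and of a point of `Y` hold for
    -- every closed set and every non-empty `Y`.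
    have hA : ∀ A : X.closeds, ∃ a, X.closeds.IsName a A := X.closeds.surjective
    have hY : ∀ Y : RepresentedSpace.{w}, (∃ y : Y, ∃ r, Y.IsName r y) ↔ Nonempty Y := fun Y =>
      ⟨fun ⟨y, _⟩ => ⟨y⟩, fun ⟨y⟩ => ⟨y, Y.surjective y⟩⟩
    simp only [hY, Set.mem_univ, true_and, hA, true_imp_iff,
      ← RepresentedSpace.continuousMulti_iff] at h
    exact h
  · have h := RepresentedSpace.tfae_compact.{u, v, w} (K := {o | Computable o}) (X := X)
      (fun _ h => h) fun _ h _ h' => Cantor.computable_pair h h'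
    simp only [← RepresentedSpace.computableMulti_iff] at h
    exact h
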